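/- **Setting.** Let $d\ge 1$, let $\Omega\subset\mathbb R^d$ be a bounded domain with boundary of class $C^2$, let $\omega\subset\Omega$ be a non-empty open set, $T>0$, $Q=\Omega\times(0,T)$, $Q_\omega=\omega\times(0,T)$, $\Sigma=\partial\Omega\times(0,T)$. Let $a\in W^{1,\infty}(Q)$ with $a\ge a_0>0$ a.e. in $Q$, let $b\in L^\infty(Q)$ and $y_0\in L^2(\Omega)$, and put $Ly=\partial_ty-\mathrm{div}(a\nabla y)+by$, $L^*z=-\partial_tz-\mathrm{div}(a\nabla z)+bz$. Let $\eta^0\in C^2(\overline\Omega)$ satisfy $\eta^0=0$ on $\partial\Omega$, $|\nabla\eta^0|>0$ in $\Omega\setminus\overline\omega$ and $\partial_\nu\eta^0<0$ on $\partial\Omega$. Let $K_1>0$ and $K_2>\max(0,\max_{\overline\Omega}\eta^0)$, and for $R>0$ set $$\rho=\exp\Big(K_1\frac{e^{K_2}-e^{\eta^0(x)}}{T-t}\Big),\qquad \rho_0=(T-t)^{3/2}\rho,\qquad \rho_R=\min(R,\rho).$$ Weak solutions are understood in $L^2(0,T;H^1_0(\Omega))$. For $v\in L^2(Q_\omega)$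 let $Mv$ be the weak solution of $Ly=v1_\omega$ in $Q$, $y=0$ on $\Sigma$, $y(\cdot,0)=0$; let $\overline y$ be the weak solution of $Ly=0$ in $Q$, $y=0$ on $\Sigma$, $y(\cdot,0)=y_0$; for $q\in L^2(Q)$ let $M^*q=z|_{Q_\omega}$, where $z$ is the weak solution of $L^*z=q$ in $Q$, $z=0$ on $\Sigma$, $z(\cdot,T)=0$. Let $\mathcal U=\{v\in L^2(Q_\omega):\rho_0v\in L^2(Q_\omega)\}$ and $$\overline F_R(y)=\tfrac12\iint_Q\rho_R^2|y+\overline y|^2\ \ (y\in L^2(Q)),\qquad G(v)=\tfrac12\iint_{Q_\omega}\rho_0^2|v|^2\ \ (v\in\mathcal U),$$ $$I_R(v)=\overline F_R(Mv)+G(v),\qquad \Phi_R(v,p)=\overline F_R(Mv-p)+G(v),$$ $$L_R(v,q)=\tfrac12\iint_{Q_\omega}\rho_0^2|v|^2-\tfrac12\iint_Q\rho_R^{-2}|q|^2-\iint_Qq\,(Mv+\overline y).$$ Let $\overline F_R^*$, $G^*$ and $\Phi_R^*$ be the convex conjugates of $\overline F_R:L^2(Q)\to\mathbb R$, $G:\mathcal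 U\to\mathbb R$ and $\Phi_R:\mathcal U\times L^2(Q)\to\mathbb R$, where the elements of $L^2(Q_\omega)\subset\mathcal U'$ act on $\mathcal U$ through the scalar product of $L^2(Q_\omega)$. **Theorem 3.1.** The problems that define $Mv$, $\overline y$ and $M^*q$ have exactly one weak solution each, and $M^*$ is the adjoint of $M$. For every $R>0$: 1. The primal problem (minimize $I_R(v)$ over $v\in\mathcal U$) and the dual problem (maximize $-\Phi_R^*(0,q)$ over $q\in L^2(Q)$) each have exactly one solution. 2. One has $$\inf_{v\in\mathcal U}I_R(v)=\inf_{v\in\mathcal U}\sup_{q\in L^2(Q)}L_R(v,q),\qquad \sup_{q\in L^2(Q)}-\Phi_R^*(0,q)=\sup_{q\in L^2(Q)}\inf_{v\in\mathcal U}L_R(v,q).$$ 3. Let $v_R$ and $q_R$ be the solutions of the primal and of the dual problem. Then $(v_R,q_R)$ is the unique saddle point of $L_R$, that is, the unique couple in $\mathcal U\times L^2(Q)$ with $L_R(v_R,q)\le L_R(v_R,q_R)\le L_R(v,q_R)$ for all $v\in\mathcal U$, $q\in L^2(Q)$. Moreover $$\inf_{v\in\mathcal U}\sup_{q\in L^2(Q)}L_R(v,q)=L_R(v_R,q_R)=\sup_{q\in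 L^2(Q)}\inf_{v\in\mathcal U}L_R(v,q).$$ 4. The extremality relations $$\overline F_R(Mv_R)+\overline F_R^*(-q_R)=-(Mv_R,q_R)_{L^2(Q)},\qquad G(v_R)+G^*(M^*q_R)=\langle M^*q_R,v_R\rangle_{\mathcal U',\mathcal U}$$ hold and, with $y_R:=Mv_R+\overline y$, $$y_R=-\rho_R^{-2}q_R\ \text{ a.e. in }Q,\qquad v_R=\rho_0^{-2}M^*q_R\ \text{ a.e. in }Q_\omega.$$ -/

import Mathlib

open MeasureTheory Set
open scoped Topology

noncomputable section

namespace NullControl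

/-- The space variable ranges over `ℝ^d` with its Euclidean structure. -/
abbrev Space (d : ℕ) : Type := EuclideanSpace ℝ (Fin d)

/-- Real `L²(S)` for a set `S` of a measure space. -/
abbrev L2 {X : Type*} [MeasureSpace X] (S : Set X) : Type _ := Lp ℝ 2 (volume.restrict S)

/-- The `L²` class of a function (only used for square integrable functions). -/
def toL2 {X : Type*} [MeasureSpace X] (S : Set X) (f : X → ℝ) : L2 S :=
  open Classical in
  if h : MemLp f 2 (volume.restrict S) then h.toLp f else 0

/-- `φ ∈ C_c^∞(S)`. -/
structure IsTest {F : Type*} [NormedAddCommGroup F] [NormedSpace ℝ F] (S : Set F) (φ : F → ℝ) :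
    Prop where
  smooth : ContDiff ℝ ((⊤ : ℕ∞) : WithTop ℕ∞) φ
  compact : HasCompactSupport φ
  supp : tsupport φ ⊆ S

/-- The spatial gradient `∇φ(x,t)`. -/
def gradX {d : ℕ} (φ : Space d × ℝ → ℝ) (z : Space d × ℝ) : Space d :=
  gradient (fun x => φ (x, z.2)) z.1

/-- The time derivative `∂_t φ(x,t)`. -/
def dt {d : ℕ} (φ : Space d × ℝ → ℝ) (z : Space d × ℝ) : ℝ :=
  deriv (fun s => φ (z.1, s)) z.2

/-- `g` is a `C²` function which, near the point `x`, defines `Ω` as the set `{g < 0}`,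
with `g x = 0` and `∇g(x) ≠ 0`. -/
def IsDefiningFunction {d : ℕ} (Ω : Set (Space d)) (x : Space d) (g : Space d → ℝ) : Prop :=
  ContDiff ℝ 2 g ∧ g x = 0 ∧ gradient g x ≠ 0 ∧ ∃ U ∈ 𝓝 x, Ω ∩ U = {y | g y < 0} ∩ U

/-- The boundary of `Ω` is of class `C²` (and `Ω` lies locally on one side of it). -/
def HasC2Boundary {d : ℕ} (Ω : Set (Space d)) : Prop :=
  ∀ x ∈ frontier Ω, ∃ g, IsDefiningFunction Ω x g

/-- `ν` is the outward unit normal of `Ω` at the boundary point `x`. -/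
def IsOutwardNormal {d : ℕ} (Ω : Set (Space d)) (x ν : Space d) : Prop :=
  ∃ g, IsDefiningFunction Ω x g ∧ ν = ‖gradient g x‖⁻¹ • gradient g x

/-- `a ∈ W^{1,∞}(S)`; here `D` is the weak derivative of `a` in all (space and time) directions. -/
def MemW1Inf {d : ℕ} (S : Set (Space d × ℝ)) (a : Space d × ℝ → ℝ) : Prop :=
  MemLp a ⊤ (volume.restrict S) ∧
  ∃ D : Space d × ℝ → (Space d × ℝ →L[ℝ] ℝ), MemLp D ⊤ (volume.restrict S) ∧
    ∀ φ, IsTest S φ → ∀ e : Space d × ℝ,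
      ∫ z in S, a z * fderiv ℝ φ z e = -∫ z in S, D z e * φ z

/-- `y ∈ L²(0,T;H¹₀(Ω))` with spatial gradient `g ∈ L²(Q)^d`, where `Q = Ω × (0,T)`.
The space `L²(0,T;H¹₀(Ω))` is described as the completion of `C_c^∞(Q)` for its norm
`(‖y‖² + ‖∇y‖²)^{1/2}`, realised inside `L²(Q) × L²(Q)^d`. -/
def InL2H10 {d : ℕ} (Q : Set (Space d × ℝ)) (y : L2 Q)
    (g : Lp (Space d) 2 (volume.restrict Q)) : Prop :=
  (y, g) ∈ closure {p : L2 Q × Lp (Space d) 2 (volume.restrict Q) |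
    ∃ φ, IsTest Q φ ∧ p.1 =ᵐ[volume.restrict Q] φ ∧ p.2 =ᵐ[volume.restrict Q] gradX φ}

/-- The Fenchel conjugate `w ↦ sup_{v ∈ S} (⟨w, v⟩ - f v)` of a real function `f` on `S`,
with respect to a pairing. -/
def fenchelConj {V W : Type*} (pairing : W → V → ℝ) (S : Set V) (f : V → ℝ) (w : W) : EReal :=
  ⨆ v ∈ S, ((pairing w v - f v : ℝ) : EReal)

/-- The data of the control problem, with their standing assumptions. -/
structure ControlProblem (d : ℕ) where
  /-- the domain -/
  Ω : Set (Space d)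
  Ω_open : IsOpen Ω
  Ω_connected : IsConnected Ω
  Ω_bounded : Bornology.IsBounded Ω
  Ω_boundary : HasC2Boundary Ω
  /-- the control region -/
  ω : Set (Space d)
  ω_open : IsOpen ω
  ω_nonempty : ω.Nonempty
  ω_subset : ω ⊆ Ω
  /-- the final time -/
  T : ℝ
  T_pos : 0 < T
  /-- the diffusion coefficient -/
  a : Space d × ℝ → ℝ
  a_mem : MemW1Inf (Ω ×ˢ Ioo 0 T) a
  a₀ : ℝ
  a₀_pos : 0 < a₀
  a_ge : ∀ᵐ z ∂(volume.restrict (Ω ×ˢ Ioo 0 T)), a₀ ≤ a z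
  /-- the potential -/
  b : Space d × ℝ → ℝ
  b_mem : MemLp b ⊤ (volume.restrict (Ω ×ˢ Ioo 0 T))
  /-- the initial state -/
  y₀ : L2 Ω
  /-- the function `η⁰` from which the weights are built -/
  η : Space d → ℝ
  η_C2 : ContDiffOn ℝ 2 η (closure Ω)
  η_boundary : ∀ x ∈ frontier Ω, η x = 0
  η_gradient : ∀ x ∈ Ω \ closure ω, gradient η x ≠ 0
  η_normal : ∀ x ∈ frontier Ω, ∀ ν, IsOutwardNormal Ω x ν → fderivWithin ℝ η (closure Ω) x ν < 0
  /-- the parameters of the weights; `K₂` is so large that the weights blow up as `t → T⁻` -/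
  K₁ : ℝ
  K₂ : ℝ
  K₁_pos : 0 < K₁
  K₂_pos : 0 < K₂
  K₂_large : ∀ x ∈ closure Ω, η x < K₂

namespace ControlProblem

variable {d : ℕ} (P : ControlProblem d)

/-- The cylinder `Q = Ω × (0,T)`. -/
abbrev Q : Set (Space d × ℝ) := P.Ω ×ˢ Ioo 0 P.T

/-- The cylinder `Q_ω = ω × (0,T)`. -/
abbrev Qω : Set (Space d × ℝ) := P.ω ×ˢ Ioo 0 P.T

/-- `α(x,t) = K₁ (e^{K₂} - e^{η⁰(x)}) / (T - t)`. -/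
def α (z : Space d × ℝ) : ℝ :=
  P.K₁ * ((Real.exp P.K₂ - Real.exp (P.η z.1)) / (P.T - z.2))

/-- `ρ = e^α`. -/
def ρ (z : Space d × ℝ) : ℝ := Real.exp (P.α z)

/-- `ρ₀ = (T - t)^{3/2} ρ`. -/
def ρ₀ (z : Space d × ℝ) : ℝ := (P.T - z.2) ^ (3 / 2 : ℝ) * P.ρ z

/-- The truncated weight `ρ_R = min(R, ρ)`. -/
def ρR (R : ℝ) (z : Space d × ℝ) : ℝ := min R (P.ρ z)

/-- `y` is the weak solution of `∂_t y - div(a∇y) + b y = f` in `Q`, `y = 0` on `∂Ω × (0,T)`,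
`y(·,0) = y₀`: it lies in `L²(0,T;H¹₀(Ω))` and satisfies the integral identity for all
`φ ∈ C_c^∞(Ω × (-∞,T))`. -/
def IsForwardSolution (f : Space d × ℝ → ℝ) (y₀ : L2 P.Ω) (y : L2 P.Q) : Prop :=
  ∃ g, InL2H10 P.Q y g ∧ ∀ φ, IsTest (P.Ω ×ˢ Iio P.T) φ →
    ∫ z in P.Q, (-(y z * dt φ z) + P.a z * inner ℝ (g z) (gradX φ z) + P.b z * y z * φ z) =
      (∫ z in P.Q, f z * φ z) + ∫ x in P.Ω, y₀ x * φ (x, 0)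

/-- `z` is the weak solution of `-∂_t z - div(a∇z) + b z = q` in `Q`, `z = 0` on `∂Ω × (0,T)`,
`z(·,T) = 0`: it lies in `L²(0,T;H¹₀(Ω))` and satisfies the integral identity for all
`φ ∈ C_c^∞(Ω × (0,∞))`. -/
def IsBackwardSolution (q : L2 P.Q) (z : L2 P.Q) : Prop :=
  ∃ g, InL2H10 P.Q z g ∧ ∀ φ, IsTest (P.Ω ×ˢ Ioi 0) φ →
    ∫ s in P.Q, (z s * dt φ s + P.a s * inner ℝ (g s) (gradX φ s) + P.b s * z s * φ s) =
      ∫ s in P.Q, q s * φ s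

/-- The extension by zero `v 𝟙_ω` of a control `v ∈ L²(Q_ω)`. -/
def extend (v : L2 P.Qω) : Space d × ℝ → ℝ := P.Qω.indicator v

/-- `M v` is the state produced by the control `v` from the initial state `0`. -/
def M (v : L2 P.Qω) : L2 P.Q :=
  Classical.epsilon fun y => P.IsForwardSolution (P.extend v) 0 y

/-- `ȳ` is the uncontrolled state, with initial state `y₀`. -/
def ybar : L2 P.Q :=
  Classical.epsilon fun y => P.IsForwardSolution 0 P.y₀ y

/-- The solution of the backward problem with right-hand side `q`. -/
def backwardState (q : L2 P.Q) : L2 P.Q :=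
  Classical.epsilon fun z => P.IsBackwardSolution q z

/-- `M* q` is the restriction to `Q_ω` of the solution of the backward problem with
right-hand side `q`. -/
def Mstar (q : L2 P.Q) : L2 P.Qω := toL2 P.Qω (P.backwardState q)

/-- The space of controls `𝒰 = {v ∈ L²(Q_ω) : ρ₀ v ∈ L²(Q_ω)}`. -/
def U : Set (L2 P.Qω) := {v | MemLp (fun z => P.ρ₀ z * v z) 2 (volume.restrict P.Qω)}

/-- `F_R(y) = ½ ∬_Q ρ_R² |y|²`. -/
def F (R : ℝ) (y : L2 P.Q) : ℝ := 1 / 2 * ∫ z in P.Q, P.ρR R z ^ 2 * y z ^ 2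

/-- `F̄_R(y) = F_R(y + ȳ)`. -/
def Fbar (R : ℝ) (y : L2 P.Q) : ℝ := P.F R (y + P.ybar)

/-- `G(v) = ½ ∬_{Q_ω} ρ₀² |v|²`. -/
def G (v : L2 P.Qω) : ℝ := 1 / 2 * ∫ z in P.Qω, P.ρ₀ z ^ 2 * v z ^ 2

/-- The truncated functional `I_R(v) = F̄_R(M v) + G(v)`. -/
def I (R : ℝ) (v : L2 P.Qω) : ℝ := P.Fbar R (P.M v) + P.G v

/-- The perturbed functional `Φ_R(v,p) = F̄_R(M v - p) + G(v)`. -/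
def Φ (R : ℝ) (vp : L2 P.Qω × L2 P.Q) : ℝ := P.Fbar R (P.M vp.1 - vp.2) + P.G vp.1

/-- The conjugate of `F̄_R` on `L²(Q)`. -/
def FbarStar (R : ℝ) (u : L2 P.Q) : EReal :=
  fenchelConj (fun u y : L2 P.Q => inner ℝ u y) univ (P.Fbar R) u

/-- The conjugate of `G : 𝒰 → ℝ`, at the elements of `𝒰'` that belong to the pivot space
`L²(Q_ω)`; the duality is then the scalar product of `L²(Q_ω)`. -/
def GStar (w : L2 P.Qω) : EReal :=
  fenchelConj (fun w v : L2 P.Qω => inner ℝ w v) P.U P.G w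

/-- The conjugate of `Φ_R : 𝒰 × L²(Q) → ℝ`. -/
def ΦStar (R : ℝ) (w : L2 P.Qω) (q : L2 P.Q) : EReal :=
  fenchelConj (fun (wq vp : L2 P.Qω × L2 P.Q) => inner ℝ wq.1 vp.1 + inner ℝ wq.2 vp.2)
    (P.U ×ˢ univ) (P.Φ R) (w, q)

/-- The Lagrangian
`L_R(v,q) = ½ ∬_{Q_ω} ρ₀² |v|² - ½ ∬_Q ρ_R^{-2} |q|² - ∬_Q q (M v + ȳ)`. -/
def Lag (R : ℝ) (v : L2 P.Qω) (q : L2 P.Q) : ℝ :=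
  P.G v - 1 / 2 * (∫ z in P.Q, (P.ρR R z ^ 2)⁻¹ * q z ^ 2) - inner ℝ q (P.M v + P.ybar)

/-- `v` solves the primal problem: minimize `I_R` over `𝒰`. -/
def IsPrimalSolution (R : ℝ) (v : L2 P.Qω) : Prop :=
  v ∈ P.U ∧ ∀ w ∈ P.U, P.I R v ≤ P.I R w

/-- `q` solves the dual problem: maximize `-Φ_R*(0,·)` over `L²(Q)`. -/
def IsDualSolution (R : ℝ) (q : L2 P.Q) : Prop :=
  ∀ p, -P.ΦStar R 0 p ≤ -P.ΦStar R 0 q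

/-- `(v,q)` is a saddle point of `L_R` on `𝒰 × L²(Q)`. -/
def IsSaddlePoint (R : ℝ) (v : L2 P.Qω) (q : L2 P.Q) : Prop :=
  v ∈ P.U ∧ (∀ p, P.Lag R v p ≤ P.Lag R v q) ∧ ∀ w ∈ P.U, P.Lag R v q ≤ P.Lag R w q

end ControlProblem

end NullControl

end

open MeasureTheory Set
open scoped Topology

noncomputable section

namespace NullControl

/-! The duality statements are completions of squares. Write `D(q)` for `dualValue`, which turns out
to be `Φ_R*(0,q)`. Completing the square in `q` (`Lag_eq_I_sub`) and in `u = ρ₀ v` (`Lag_divρ₀`)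
gives two expressions of the Lagrangian, whose comparison yields the gap identity `I_add_dualValue`:
`I_R(v) + D(q) = ½‖ρ_R⁻¹ q + ρ_R (M v + ȳ)‖² + ½‖ρ₀ v - ρ₀⁻¹ M* q‖²`. Both squares vanish for some
couple exactly when `v = ρ₀⁻² M* q` and `ρ_R⁻² q + M ρ₀⁻² M* q + ȳ = 0`. The operator in the last
equation is bounded and coercive, because `ρ_R` lies between `min(R,1)` and `R` and `M ρ₀⁻² M*` is
nonnegative, so Lax–Milgram solves it (`exists_optimalitySystem`). Existence, uniqueness, absence of
a duality gap, the saddle point and the extremality relations all follow from the gap identity.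

This requires that `M` and `M*` be well defined and adjoint to each other. Existence of weak
solutions comes from Lions' projection theorem and an energy estimate with an exponential weight in
time (`exists_weak_solution`). Adjointness is Green's formula
(`inner_eq_inner_of_satisfiesWeakForm`), obtained without time traces: with `Y`, `Z` the extensions
by zero of a forward and a backward solution, `s ↦ ⟨Y, τ_s Z⟩ = ⟨Z, τ_{-s} Y⟩` has a right
derivative at `0` that each of the two equations computes. Uniqueness for each problem follows from
existence for the adjoint one, and continuity of `M` and `M*` from adjointness alone. -/

/-! ### Multiplication operators -/

section Mul

variable {X : Type*} [MeasurableSpace X] {μ : Measure X} {F : Type*} [NormedAddCommGroup F]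

/-- Multiplication of `L²` functions by an essentially bounded function. -/
def mulL [NormedSpace ℝ F] {m : X → ℝ} (hm : MemLp m ⊤ μ) : Lp F 2 μ →L[ℝ] Lp F 2 μ :=
  (ContinuousLinearMap.lsmul ℝ ℝ : ℝ →L[ℝ] F →L[ℝ] F).holderL μ ⊤ 2 2 (hm.toLp m)

lemma mulL_coeFn [NormedSpace ℝ F] {m : X → ℝ} (hm : MemLp m ⊤ μ) (u : Lp F 2 μ) :
    mulL hm u =ᵐ[μ] fun x => m x • u x := by
  have h := (ContinuousLinearMap.lsmul ℝ ℝ : ℝ →L[ℝ] F →L[ℝ] F).coeFn_holder (r := 2)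
    (hm.toLp m) u
  filter_upwards [h, hm.coeFn_toLp] with x hx hx'
  simp only [mulL, ContinuousLinearMap.holderL_apply_apply]
  rw [hx, hx']
  rfl

lemma inner_mulL [InnerProductSpace ℝ F] {m : X → ℝ} (hm : MemLp m ⊤ μ) (u v : Lp F 2 μ) :
    inner ℝ (mulL hm u) v = inner ℝ u (mulL hm v) := by
  rw [L2.inner_def, L2.inner_def]
  refine integral_congr_ae ?_
  filter_upwards [mulL_coeFn hm u, mulL_coeFn hm v] with x h1 h2
  rw [h1, h2, real_inner_smul_left, real_inner_smul_right]

lemma norm_sq_eq_integral (u : Lp ℝ 2 μ) : ‖u‖ ^ 2 = ∫ x, u x ^ 2 ∂μ := by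
  rw [← real_inner_self_eq_norm_sq, L2.inner_def]
  exact integral_congr_ae (.of_forall fun x => by simp)

lemma norm_mulL_sq {m : X → ℝ} (hm : MemLp m ⊤ μ) (u : Lp ℝ 2 μ) :
    ‖mulL hm u‖ ^ 2 = ∫ x, m x ^ 2 * u x ^ 2 ∂μ := by
  rw [norm_sq_eq_integral]
  refine integral_congr_ae ?_
  filter_upwards [mulL_coeFn hm u] with x h
  rw [h, smul_eq_mul, mul_pow]

lemma mulL_mulL_cancel {m n : X → ℝ} (hm : MemLp m ⊤ μ) (hn : MemLp n ⊤ μ)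
    (h : ∀ᵐ x ∂μ, m x * n x = 1) (u : Lp ℝ 2 μ) : mulL hm (mulL hn u) = u := by
  refine Lp.ext ?_
  filter_upwards [mulL_coeFn hm (mulL hn u), mulL_coeFn hn u, h] with x h1 h2 h3
  rw [h1, h2, smul_eq_mul, smul_eq_mul, ← mul_assoc, h3, one_mul]

end Mul

/-! ### Lions' projection theorem -/

/-- Lions' projection theorem: the equations `⟪u, K φ⟫ = ℓ φ` are solvable in `V` as soon as
`|ℓ φ|` is controlled by the norm of the functional `K φ` on `V`. -/
theorem exists_mem_forall_inner_eq {W D : Type*} [NormedAddCommGroup W] [InnerProductSpace ℝ W]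
    [CompleteSpace W] [AddCommGroup D] [Module ℝ D] (V : Submodule ℝ W)
    [V.HasOrthogonalProjection] (K : D →ₗ[ℝ] W) (l : D →ₗ[ℝ] ℝ) (C : ℝ)
    (h : ∀ φ, |l φ| ≤ C * ‖V.starProjection (K φ)‖) :
    ∃ u ∈ V, ∀ φ, inner ℝ u (K φ) = l φ := by
  let T : D →ₗ[ℝ] W := V.starProjection.toLinearMap ∘ₗ K
  have hker : LinearMap.ker T ≤ LinearMap.ker l := by
    intro φ hφ
    have h0 : V.starProjection (K φ) = 0 := hφ
    have := h φ
    rw [h0, norm_zero, mul_zero] at this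
    exact abs_eq_zero.1 (le_antisymm this (abs_nonneg _))
  let g : LinearMap.range T →ₗ[ℝ] ℝ :=
    (LinearMap.ker T).liftQ l hker ∘ₗ T.quotKerEquivRange.symm.toLinearMap
  have hg : ∀ φ, g ⟨T φ, LinearMap.mem_range_self T φ⟩ = l φ := by
    intro φ
    have : T.quotKerEquivRange.symm ⟨T φ, LinearMap.mem_range_self T φ⟩ =
        (LinearMap.ker T).mkQ φ := by
      rw [LinearEquiv.symm_apply_eq]
      rfl
    simp only [g, LinearMap.comp_apply, LinearEquiv.coe_coe, this]
    exact Submodule.liftQ_apply _ _ _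
  have hgC : ∀ x, ‖g x‖ ≤ C * ‖x‖ := by
    rintro ⟨_, φ, rfl⟩
    rw [hg φ]
    exact h φ
  obtain ⟨G, hG, -⟩ := exists_extension_norm_eq (𝕜 := ℝ) (LinearMap.range T)
    (g.mkContinuous C hgC)
  let u := (InnerProductSpace.toDual ℝ W).symm G
  -- The functional was extended from the range of `V.starProjection ∘ K`, so its Riesz
  -- representative `u` need not lie in `V`. Projecting `u` is harmless, since the projection is
  -- self-adjoint and can be moved onto `K φ`.
  refine ⟨V.starProjection u, Submodule.starProjection_apply_mem V u, fun φ => ?_⟩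
  rw [Submodule.inner_starProjection_left_eq_right, InnerProductSpace.toDual_symm_apply]
  have := hG ⟨T φ, LinearMap.mem_range_self T φ⟩
  rw [LinearMap.mkContinuous_apply, hg] at this
  exact this

/-! ### Maps with an adjoint -/

section Adjoint

variable {X Y : Type*} [NormedAddCommGroup X] [InnerProductSpace ℝ X]
  [NormedAddCommGroup Y] [InnerProductSpace ℝ Y] [CompleteSpace Y]

/-- An everywhere defined map with an everywhere defined adjoint is linear and continuous
(Hellinger–Toeplitz). -/
theorem exists_clm_of_adjoint [CompleteSpace X] (f : X → Y) (g : Y → X)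
    (h : ∀ x y, inner ℝ (f x) y = inner ℝ x (g y)) : ∃ A : X →L[ℝ] Y, ∀ x, A x = f x := by
  let f' : X →ₗ[ℝ] Y :=
    { toFun := f
      map_add' := fun x x' => ext_inner_right ℝ fun y => by
        rw [inner_add_left, h, h, h, inner_add_left]
      map_smul' := fun c x => ext_inner_right ℝ fun y => by
        rw [RingHom.id_apply, real_inner_smul_left, h, h, real_inner_smul_left] }
  refine ⟨⟨f', f'.continuous_of_seq_closed_graph ?_⟩, fun x => rfl⟩
  intro u x y hu hy
  refine ext_inner_right ℝ fun q => ?_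
  have h1 : Filter.Tendsto (fun n => inner ℝ (f (u n)) q) Filter.atTop (𝓝 (inner ℝ y q)) :=
    Filter.Tendsto.inner hy tendsto_const_nhds
  have h2 : Filter.Tendsto (fun n => inner ℝ (u n) (g q)) Filter.atTop (𝓝 (inner ℝ x (g q))) :=
    Filter.Tendsto.inner hu tendsto_const_nhds
  simp_rw [h] at h1
  rw [tendsto_nhds_unique h1 h2, ← h]
  rfl

/-- Solvability of the optimality system `r² q + A A* q + ȳ = 0`. -/
theorem exists_optimality_system (A : X →L[ℝ] Y) (B : Y →L[ℝ] X) (r s : Y →L[ℝ] Y)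
    (hAB : ∀ x y, inner ℝ (A x) y = inner ℝ x (B y)) (hr : ∀ x y, inner ℝ (r x) y = inner ℝ x (r y))
    (hsr : ∀ y, s (r y) = y) (y₀ : Y) : ∃ q, r (r q) + A (B q) + y₀ = 0 := by
  let S : Y →L[ℝ] Y := r ∘L r + A ∘L B
  let b : Y →L[ℝ] Y →L[ℝ] ℝ := innerSL ℝ ∘L S
  have hb : ∀ q p, b q p = inner ℝ (r q) (r p) + inner ℝ (B q) (B p) := by
    intro q p
    change inner ℝ (r (r q) + A (B q)) p = _
    rw [inner_add_left, hr, hAB]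
  have hs : 0 < ‖s‖ + 1 := by positivity
  have hco : IsCoercive b := by
    -- Coercivity comes from `r` alone, as `s` is a left inverse of `r`; the term with `B` is only
    -- nonnegative. The `+ 1` keeps the constant meaningful when `s = 0`.
    refine ⟨((‖s‖ + 1) ^ 2)⁻¹, by positivity, fun q => ?_⟩
    rw [hb, real_inner_self_eq_norm_sq, real_inner_self_eq_norm_sq]
    have h1 : ‖q‖ ≤ (‖s‖ + 1) * ‖r q‖ := by
      calc ‖q‖ = ‖s (r q)‖ := by rw [hsr]
        _ ≤ ‖s‖ * ‖r q‖ := s.le_opNorm _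
        _ ≤ _ := by gcongr; linarith
    have h2 : ‖q‖ * ‖q‖ ≤ ((‖s‖ + 1) ^ 2) * ‖r q‖ ^ 2 := by
      rw [← mul_pow, ← pow_two]
      gcongr
    rw [mul_assoc, inv_mul_le_iff₀ (by positivity)]
    nlinarith [mul_nonneg (sq_nonneg (‖s‖ + 1)) (sq_nonneg ‖B q‖)]
  refine ⟨hco.continuousLinearEquivOfBilin.symm (-y₀), ?_⟩
  set q := hco.continuousLinearEquivOfBilin.symm (-y₀) with hq
  refine ext_inner_right ℝ fun p => ?_
  have h1 := hco.continuousLinearEquivOfBilin_apply q p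
  rw [hq, ContinuousLinearEquiv.apply_symm_apply, ← hq] at h1
  change inner ℝ (-y₀) p = inner ℝ (r (r q) + A (B q)) p at h1
  rw [inner_add_left, ← h1, inner_neg_left, inner_zero_left]
  ring

end Adjoint

end NullControl

namespace NullControl

/-! ### Test functions -/

namespace IsTest

variable {F : Type*} [NormedAddCommGroup F] [NormedSpace ℝ F] {S S' : Set F} {φ ψ : F → ℝ}

lemma mono (hφ : IsTest S φ) (h : S ⊆ S') : IsTest S' φ :=
  ⟨hφ.smooth, hφ.compact, hφ.supp.trans h⟩

lemma continuous (hφ : IsTest S φ) : Continuous φ := hφ.smooth.continuous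

lemma differentiable (hφ : IsTest S φ) : Differentiable ℝ φ :=
  hφ.smooth.differentiable (by simp)

lemma contDiff_one (hφ : IsTest S φ) : ContDiff ℝ 1 φ := hφ.smooth.of_le (by exact_mod_cast le_top)

lemma eq_zero (hφ : IsTest S φ) {z : F} (hz : z ∉ S) : φ z = 0 :=
  image_eq_zero_of_notMem_tsupport fun h => hz (hφ.supp h)

lemma fderiv_eq_zero (hφ : IsTest S φ) {z : F} (hz : z ∉ S) : fderiv ℝ φ z = 0 :=
  image_eq_zero_of_notMem_tsupport fun h => hz (hφ.supp (tsupport_fderiv_subset ℝ h))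

lemma continuous_fderiv (hφ : IsTest S φ) : Continuous (fderiv ℝ φ) :=
  hφ.contDiff_one.continuous_fderiv one_ne_zero

lemma zero : IsTest S (0 : F → ℝ) :=
  ⟨contDiff_const, HasCompactSupport.zero, by simp [tsupport]⟩

lemma add (hφ : IsTest S φ) (hψ : IsTest S ψ) : IsTest S (φ + ψ) :=
  ⟨hφ.smooth.add hψ.smooth, hφ.compact.add hψ.compact,
    (tsupport_add φ ψ).trans (union_subset hφ.supp hψ.supp)⟩

lemma mul_left {w : F → ℝ} (hw : ContDiff ℝ ((⊤ : ℕ∞) : WithTop ℕ∞) w) (hφ : IsTest S φ) :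
    IsTest S (fun z => w z * φ z) :=
  ⟨hw.mul hφ.smooth, hφ.compact.mul_left, (tsupport_mul_subset_right).trans hφ.supp⟩

lemma smul (c : ℝ) (hφ : IsTest S φ) : IsTest S (c • φ) := mul_left contDiff_const hφ

lemma comp_add (hφ : IsTest S φ) (c : F) :
    IsTest ((fun z => z + c) ⁻¹' S) (fun z => φ (z + c)) where
  smooth := hφ.smooth.comp (contDiff_id.add contDiff_const)
  compact := hφ.compact.comp_homeomorph (Homeomorph.addRight c)
  supp := by
    have : tsupport (φ ∘ Homeomorph.addRight c) = Homeomorph.addRight c ⁻¹' tsupport φ :=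
      tsupport_comp_eq_preimage φ (Homeomorph.addRight c)
    exact this.trans_subset (preimage_mono hφ.supp)

end IsTest

/-- The space `C_c^∞(S)`. -/
def testSpace {F : Type*} [NormedAddCommGroup F] [NormedSpace ℝ F] (S : Set F) :
    Submodule ℝ (F → ℝ) where
  carrier := {φ | IsTest S φ}
  add_mem' := IsTest.add
  zero_mem' := IsTest.zero
  smul_mem' c _ h := IsTest.smul c h

lemma isTest_coe {F : Type*} [NormedAddCommGroup F] [NormedSpace ℝ F] {S : Set F}
    (φ : testSpace S) : IsTest S φ.1 := φ.2

section SpaceTime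

variable {d : ℕ} {S : Set (Space d × ℝ)} {φ ψ : Space d × ℝ → ℝ}

lemma hasFDerivAt_slice_space (z : Space d × ℝ) (h : DifferentiableAt ℝ φ z) :
    HasFDerivAt (fun x => φ (x, z.2))
      ((fderiv ℝ φ z).comp (ContinuousLinearMap.inl ℝ (Space d) ℝ)) z.1 :=
  HasFDerivAt.comp z.1 h.hasFDerivAt (hasFDerivAt_prodMk_left z.1 z.2)

lemma inner_gradX (h : Differentiable ℝ φ) (x : Space d) (z : Space d × ℝ) :
    inner ℝ (gradX φ z) x = fderiv ℝ φ z (x, 0) := by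
  rw [gradX, gradient, InnerProductSpace.toDual_symm_apply,
    (hasFDerivAt_slice_space z (h z)).fderiv]
  rfl

lemma hasDerivAt_slice_time (h : Differentiable ℝ φ) (x : Space d) (t : ℝ) :
    HasDerivAt (fun s => φ (x, s)) (fderiv ℝ φ (x, t) (0, 1)) t := by
  have h1 : HasDerivAt (fun s : ℝ => (x, s)) ((0 : Space d), (1 : ℝ)) t :=
    (hasDerivAt_const t x).prodMk (hasDerivAt_id t)
  exact (h (x, t)).hasFDerivAt.comp_hasDerivAt t h1

lemma dt_eq (h : Differentiable ℝ φ) (z : Space d × ℝ) : dt φ z = fderiv ℝ φ z (0, 1) :=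
  (hasDerivAt_slice_time h z.1 z.2).deriv

lemma gradX_eq (h : Differentiable ℝ φ) : gradX φ = fun z =>
    (InnerProductSpace.toDual ℝ (Space d)).symm
      ((fderiv ℝ φ z).comp (ContinuousLinearMap.inl ℝ (Space d) ℝ)) := by
  ext1 z
  rw [gradX, gradient, (hasFDerivAt_slice_space z (h z)).fderiv]

lemma IsTest.continuous_gradX (hφ : IsTest S φ) : Continuous (gradX φ) := by
  rw [gradX_eq hφ.differentiable]
  exact (LinearIsometryEquiv.continuous _).comp
    (hφ.continuous_fderiv.clm_comp continuous_const)

lemma IsTest.continuous_dt (hφ : IsTest S φ) : Continuous (dt φ) := by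
  rw [show dt φ = fun z => fderiv ℝ φ z (0, 1) from funext (dt_eq hφ.differentiable)]
  exact hφ.continuous_fderiv.clm_apply continuous_const

lemma gradX_eq_zero (h : Differentiable ℝ φ) {z : Space d × ℝ} (hz : fderiv ℝ φ z = 0) :
    gradX φ z = 0 := by
  rw [gradX_eq h]; simp [hz]

lemma dt_eq_zero (h : Differentiable ℝ φ) {z : Space d × ℝ} (hz : fderiv ℝ φ z = 0) :
    dt φ z = 0 := by
  rw [dt_eq h, hz]; rfl

lemma IsTest.hasCompactSupport_gradX (hφ : IsTest S φ) : HasCompactSupport (gradX φ) :=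
  (hφ.compact.fderiv ℝ).mono fun _ hz h0 => hz (gradX_eq_zero hφ.differentiable h0)

lemma IsTest.hasCompactSupport_dt (hφ : IsTest S φ) : HasCompactSupport (dt φ) :=
  (hφ.compact.fderiv ℝ).mono fun _ hz h0 => hz (dt_eq_zero hφ.differentiable h0)

lemma IsTest.gradX_zero (hφ : IsTest S φ) {z : Space d × ℝ} (hz : z ∉ S) : gradX φ z = 0 :=
  gradX_eq_zero hφ.differentiable (hφ.fderiv_eq_zero hz)

lemma IsTest.memLp (hφ : IsTest S φ) : MemLp φ 2 volume :=
  hφ.continuous.memLp_of_hasCompactSupport hφ.compact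

lemma IsTest.memLp_gradX (hφ : IsTest S φ) : MemLp (gradX φ) 2 volume :=
  hφ.continuous_gradX.memLp_of_hasCompactSupport hφ.hasCompactSupport_gradX

lemma IsTest.memLp_dt (hφ : IsTest S φ) : MemLp (dt φ) 2 volume :=
  hφ.continuous_dt.memLp_of_hasCompactSupport hφ.hasCompactSupport_dt

lemma gradX_add (hφ : Differentiable ℝ φ) (hψ : Differentiable ℝ ψ) (z : Space d × ℝ) :
    gradX (φ + ψ) z = gradX φ z + gradX ψ z := by
  refine ext_inner_right ℝ fun x => ?_
  rw [inner_add_left, inner_gradX hφ, inner_gradX hψ, inner_gradX (hφ.add hψ),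
    fderiv_add (hφ z) (hψ z)]
  rfl

lemma dt_add (hφ : Differentiable ℝ φ) (hψ : Differentiable ℝ ψ) (z : Space d × ℝ) :
    dt (φ + ψ) z = dt φ z + dt ψ z := by
  rw [dt_eq hφ, dt_eq hψ, dt_eq (hφ.add hψ), fderiv_add (hφ z) (hψ z)]
  rfl

lemma gradX_smul (c : ℝ) (hφ : Differentiable ℝ φ) (z : Space d × ℝ) :
    gradX (c • φ) z = c • gradX φ z := by
  refine ext_inner_right ℝ fun x => ?_
  rw [real_inner_smul_left, inner_gradX hφ, inner_gradX (hφ.const_smul c),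
    fderiv_const_smul (hφ z)]
  rfl

lemma dt_smul (c : ℝ) (hφ : Differentiable ℝ φ) (z : Space d × ℝ) :
    dt (c • φ) z = c * dt φ z := by
  rw [dt_eq hφ, dt_eq (hφ.const_smul c), fderiv_const_smul (hφ z)]
  rfl

/-- Multiplication by a function of time commutes with the spatial gradient. -/
lemma gradX_time_mul (w : ℝ → ℝ) (hφ : Differentiable ℝ φ) (z : Space d × ℝ) :
    gradX (fun z => w z.2 * φ z) z = w z.2 • gradX φ z := by
  refine ext_inner_right ℝ fun x => ?_
  have h := (hasFDerivAt_slice_space z (hφ z)).const_mul (w z.2)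
  rw [gradX, gradient, InnerProductSpace.toDual_symm_apply, h.fderiv, real_inner_smul_left,
    inner_gradX hφ]
  rfl

lemma differentiable_comp_add (hφ : Differentiable ℝ φ) (c : Space d × ℝ) :
    Differentiable ℝ fun z => φ (z + c) :=
  hφ.comp (differentiable_id.add_const c)

lemma gradX_comp_add (c : Space d × ℝ) (hφ : Differentiable ℝ φ) (z : Space d × ℝ) :
    gradX (fun z => φ (z + c)) z = gradX φ (z + c) := by
  refine ext_inner_right ℝ fun x => ?_
  rw [inner_gradX hφ, inner_gradX (differentiable_comp_add hφ c), fderiv_comp_add_right]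

lemma dt_comp_add (c : Space d × ℝ) (hφ : Differentiable ℝ φ) (z : Space d × ℝ) :
    dt (fun z => φ (z + c)) z = dt φ (z + c) := by
  rw [dt_eq hφ, dt_eq (differentiable_comp_add hφ c), fderiv_comp_add_right]

lemma IsTest.time_mul {w : ℝ → ℝ} (hw : ContDiff ℝ ((⊤ : ℕ∞) : WithTop ℕ∞) w) (hφ : IsTest S φ) :
    IsTest S (fun z => w z.2 * φ z) :=
  IsTest.mul_left (w := fun z : Space d × ℝ => w z.2) (hw.comp contDiff_snd) hφ

end SpaceTime

/-! ### Extension by zero and translation of `L²` functions -/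

section Extension

variable {X : Type*} [MeasureSpace X] {S : Set X} {F : Type*} [NormedAddCommGroup F]

lemma indicator_ae_congr (hS : MeasurableSet S) {f g : X → F} (h : f =ᵐ[volume.restrict S] g) :
    S.indicator f =ᵐ[volume] S.indicator g := by
  filter_upwards [(ae_restrict_iff' hS).1 h] with z hz
  by_cases hzS : z ∈ S <;> simp [hzS, hz]

lemma memLp_indicator (hS : MeasurableSet S) (u : Lp F 2 (volume.restrict S)) :
    MemLp (S.indicator u) 2 volume :=
  (memLp_indicator_iff_restrict hS).2 (Lp.memLp u)

/-- Extension of `L²` functions by zero. -/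
def zeroExt [InnerProductSpace ℝ F] (hS : MeasurableSet S) :
    Lp F 2 (volume.restrict S) →ₗᵢ[ℝ] Lp F 2 (volume : Measure X) where
  toFun u := (memLp_indicator hS u).toLp (S.indicator u)
  map_add' u v := by
    rw [← MemLp.toLp_add]
    refine MemLp.toLp_congr _ _ ?_
    rw [← indicator_add']
    exact indicator_ae_congr hS (Lp.coeFn_add u v)
  map_smul' c u := by
    rw [RingHom.id_apply, ← MemLp.toLp_const_smul]
    refine MemLp.toLp_congr _ _ ?_
    refine (indicator_ae_congr hS (Lp.coeFn_smul c u)).trans (.of_eq ?_)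
    exact indicator_const_smul S c u
  norm_map' u := by
    change ‖(memLp_indicator hS u).toLp (S.indicator u)‖ = _
    rw [Lp.norm_toLp, Lp.norm_def, eLpNorm_indicator_eq_eLpNorm_restrict hS]

lemma zeroExt_coeFn [InnerProductSpace ℝ F] (hS : MeasurableSet S)
    (u : Lp F 2 (volume.restrict S)) :
    zeroExt hS u =ᵐ[volume] S.indicator u :=
  (memLp_indicator hS u).coeFn_toLp

lemma integral_inner_zeroExt [InnerProductSpace ℝ F] (hS : MeasurableSet S)
    (u : Lp F 2 (volume.restrict S)) (f : X → F) :
    ∫ z, inner ℝ (zeroExt hS u z) (f z) = ∫ z in S, inner ℝ (u z) (f z) := by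
  rw [← integral_indicator hS]
  refine integral_congr_ae ?_
  filter_upwards [zeroExt_coeFn hS u] with z hz
  rw [hz]
  by_cases h : z ∈ S <;> simp [h]

lemma zeroExt_eq_toLp [InnerProductSpace ℝ F] (hS : MeasurableSet S)
    {u : Lp F 2 (volume.restrict S)} {f : X → F}
    (hf : MemLp f 2 volume) (hf0 : ∀ z ∉ S, f z = 0) (h : u =ᵐ[volume.restrict S] f) :
    zeroExt hS u = hf.toLp f := by
  refine MemLp.toLp_congr (memLp_indicator hS u) _ ?_
  refine (indicator_ae_congr hS h).trans (.of_eq ?_)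
  exact indicator_eq_self.2 fun z hz => by_contra fun h0 => hz (hf0 z h0)

end Extension


section Translation

variable {d : ℕ} {F : Type*} [NormedAddCommGroup F]

instance : (volume : Measure (Space d × ℝ)).IsAddHaarMeasure :=
  inferInstanceAs ((volume : Measure (Space d)).prod (volume : Measure ℝ)).IsAddHaarMeasure

lemma measurePreserving_timeShift (s : ℝ) :
    MeasurePreserving (ContinuousMap.addRight ((0, s) : Space d × ℝ)) volume volume :=
  measurePreserving_add_right volume ((0, s) : Space d × ℝ)

/-- Translation in time: `(τ_s u)(x,t) = u(x,t+s)`. -/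
def timeShift (s : ℝ) (u : Lp F 2 (volume : Measure (Space d × ℝ))) :
    Lp F 2 (volume : Measure (Space d × ℝ)) :=
  Lp.compMeasurePreserving _ (measurePreserving_timeShift s) u

lemma timeShift_coeFn (s : ℝ) (u : Lp F 2 (volume : Measure (Space d × ℝ))) :
    timeShift s u =ᵐ[volume] fun z => u (z + (0, s)) :=
  Lp.coeFn_compMeasurePreserving u (measurePreserving_timeShift s)

lemma isometry_timeShift (s : ℝ) :
    Isometry (timeShift s : Lp F 2 (volume : Measure (Space d × ℝ)) → _) :=
  Lp.isometry_compMeasurePreserving (measurePreserving_timeShift s)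

lemma norm_timeShift_sub (s : ℝ) (u v : Lp F 2 (volume : Measure (Space d × ℝ))) :
    ‖timeShift s u - timeShift s v‖ = ‖u - v‖ := by
  rw [← dist_eq_norm, ← dist_eq_norm]
  exact (isometry_timeShift s).dist_eq u v

lemma continuous_timeShift (u : Lp F 2 (volume : Measure (Space d × ℝ))) :
    Continuous fun s => timeShift s u := by
  refine Continuous.compMeasurePreservingLp continuous_const ?_ measurePreserving_timeShift
    (by norm_num)
  exact ContinuousMap.continuous_of_continuous_uncurry _ (by
    simp only [Function.uncurry_def, ContinuousMap.coe_addRight]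
    fun_prop)

lemma timeShift_zero (u : Lp F 2 (volume : Measure (Space d × ℝ))) : timeShift 0 u = u := by
  refine Lp.ext ?_
  filter_upwards [timeShift_coeFn 0 u] with z hz
  rw [hz, show ((0, 0) : Space d × ℝ) = 0 from rfl, add_zero]

lemma timeShift_toLp (s : ℝ) {f : Space d × ℝ → F} (hf : MemLp f 2 volume) :
    timeShift s (hf.toLp f) =ᵐ[volume] fun z => f (z + (0, s)) := by
  refine (timeShift_coeFn s _).trans ?_
  exact (measurePreserving_timeShift s).quasiMeasurePreserving.ae_eq_comp
    hf.coeFn_toLp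

lemma inner_timeShift_right [InnerProductSpace ℝ F] (s : ℝ)
    (u v : Lp F 2 (volume : Measure (Space d × ℝ))) :
    inner ℝ u (timeShift s v) = inner ℝ v (timeShift (-s) u) := by
  rw [L2.inner_def, L2.inner_def]
  calc ∫ z, inner ℝ (u z) (timeShift s v z)
      = ∫ z, inner ℝ (u z) (v (z + (0, s))) :=
        integral_congr_ae ((timeShift_coeFn s v).mono fun z hz => by simp only [hz])
    _ = ∫ z, inner ℝ (u (z + (0, s) + (0, -s))) (v (z + (0, s))) := by
        simp only [add_assoc, Prod.mk_add_mk, add_zero, add_neg_cancel, Prod.mk_zero_zero]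
    _ = ∫ z, inner ℝ (u (z + (0, -s))) (v z) :=
        integral_add_right_eq_self (fun z => inner ℝ (u (z + (0, -s))) (v z)) (0, s)
    _ = _ := integral_congr_ae ((timeShift_coeFn (-s) u).mono fun z hz => by
        simp only [hz, real_inner_comm])

/-- Differentiation in `s` of `⟨Y, τ_{σ s} φ⟩` for a test function `φ`. -/
lemma hasDerivAt_inner_timeShift {S : Set (Space d × ℝ)} {φ : Space d × ℝ → ℝ} (hφ : IsTest S φ)
    (Y : Lp ℝ 2 (volume : Measure (Space d × ℝ))) (σ s : ℝ) :
    HasDerivAt (fun s => inner ℝ Y (timeShift (σ * s) (hφ.memLp.toLp φ)))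
      (∫ z, Y z * (σ * dt φ (z + (0, σ * s)))) s := by
  -- With the reflection `ψ` of `φ`, the pairing is the convolution `Y ⋆ ψ` evaluated at `(0, -σ
  -- s)`, so the derivative falls on the smooth factor. The sign from the reflection cancels the one
  -- from `-σ s`.
  let ψ : Space d × ℝ → ℝ := fun w => φ (-w)
  have hψ : ContDiff ℝ 1 ψ := hφ.contDiff_one.comp contDiff_neg
  have hψc : HasCompactSupport ψ := hφ.compact.comp_homeomorph (Homeomorph.neg _)
  have hY : LocallyIntegrable Y (volume : Measure (Space d × ℝ)) :=
    (Lp.memLp Y).locallyIntegrable (by norm_num)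
  let L := ContinuousLinearMap.mul ℝ ℝ
  have h1 := hψc.hasFDerivAt_convolution_right L hY hψ ((0, -(σ * s)) : Space d × ℝ)
  have h2 : HasDerivAt (fun s : ℝ => ((0, -(σ * s)) : Space d × ℝ)) ((0, -σ) : Space d × ℝ) s := by
    have := ((hasDerivAt_id s).const_mul σ).neg
    simpa using (hasDerivAt_const s (0 : Space d)).prodMk this
  have h3 := h1.comp_hasDerivAt s h2
  rw [convolution_precompR_apply L hY (hψc.fderiv ℝ) (hψ.continuous_fderiv one_ne_zero)] at h3
  have hf : (fun s => inner ℝ Y (timeShift (σ * s) (hφ.memLp.toLp φ))) =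
      (fun x => convolution Y ψ L volume x) ∘ fun s : ℝ => ((0, -(σ * s)) : Space d × ℝ) := by
    ext1 s
    rw [L2.inner_def, Function.comp_apply, convolution_def]
    refine integral_congr_ae ?_
    filter_upwards [timeShift_toLp (σ * s) hφ.memLp] with z hz
    rw [hz]
    have : -(((0, -(σ * s)) : Space d × ℝ) - z) = z + (0, σ * s) := by
      rw [neg_sub, sub_eq_add_neg]; simp
    simp only [L, ψ, ContinuousLinearMap.mul_apply', this]
    exact mul_comm _ _
  rw [hf]
  refine h3.congr_deriv ?_
  rw [convolution_def]
  refine integral_congr_ae (.of_forall fun z => ?_)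
  have : -(((0, -(σ * s)) : Space d × ℝ) - z) = z + (0, σ * s) := by
    rw [neg_sub, sub_eq_add_neg]; simp
  have hd : fderiv ℝ ψ ((0, -(σ * s)) - z) = -fderiv ℝ φ (z + (0, σ * s)) := by
    rw [← this]
    have := (hφ.differentiable (-((0, -(σ * s)) - z))).hasFDerivAt.comp ((0, -(σ * s)) - z)
      (hasFDerivAt_id ((0, -(σ * s)) - z)).neg
    refine this.fderiv.trans ?_
    ext v <;> simp
  simp only [L, ContinuousLinearMap.mul_apply', hd, dt_eq hφ.differentiable]
  have : ((0, -σ) : Space d × ℝ) = (-σ) • ((0, 1) : Space d × ℝ) := by simp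
  rw [this, map_smul]
  simp

/-- If `Y` satisfies `⟨Y, σ ∂_t φ⟩ = ⟨Λ₀, φ⟩ + ⟨Λ₁, ∇φ⟩` for all `φ` which are translates by
`σ s`, `s ≥ 0`, of test functions on `Q`, then `s ↦ ⟨Y, τ_{σ s} Z⟩` has the right derivative
`⟨Λ₀, Z⟩ + ⟨Λ₁, ∇Z⟩` at `0` for all `Z` in the closure of the test functions. -/
theorem hasDerivWithinAt_inner_timeShift {Q : Set (Space d × ℝ)} (σ : ℝ)
    (Y Λ₀ : Lp ℝ 2 (volume : Measure (Space d × ℝ)))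
    (Λ₁ : Lp (Space d) 2 (volume : Measure (Space d × ℝ)))
    (h : ∀ φ, IsTest Q φ → ∀ s : ℝ, 0 ≤ s → ∫ z, Y z * (σ * dt φ (z + (0, σ * s))) =
      (∫ z, Λ₀ z * φ (z + (0, σ * s))) + ∫ z, inner ℝ (Λ₁ z) (gradX φ (z + (0, σ * s))))
    {Z : Lp ℝ 2 (volume : Measure (Space d × ℝ))}
    {G : Lp (Space d) 2 (volume : Measure (Space d × ℝ))}
    (hZ : (Z, G) ∈ closure {p : Lp ℝ 2 (volume : Measure (Space d × ℝ)) ×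
      Lp (Space d) 2 (volume : Measure (Space d × ℝ)) |
        ∃ φ, ∃ hφ : IsTest Q φ, p = (hφ.memLp.toLp φ, hφ.memLp_gradX.toLp (gradX φ))}) :
    HasDerivWithinAt (fun s => inner ℝ Y (timeShift (σ * s) Z)) (inner ℝ Λ₀ Z + inner ℝ Λ₁ G)
      (Ici 0) 0 := by
  set D := inner ℝ Λ₀ Z + inner ℝ Λ₁ G with hD
  have key : ∀ η t : ℝ, 0 ≤ t →
      (∀ s ∈ Icc 0 t, ‖timeShift (σ * s) Z - Z‖ ≤ η ∧ ‖timeShift (σ * s) G - G‖ ≤ η) →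
      ‖inner ℝ Y (timeShift (σ * t) Z) - inner ℝ Y Z - t * D‖ ≤
        (‖Λ₀‖ + ‖Λ₁‖) * η * t := by
    intro η t ht hη
    -- Convergence in the closure controls values and spatial gradients but not time derivatives, so
    -- the derivative itself cannot pass to the limit. The integrated estimate at a fixed time `t`
    -- involves only `p` and its translate: it is a closed condition on `(p, g)`, holds for test
    -- functions by the mean value inequality, and therefore holds at `(Z, G)`.
    let C : Set (Lp ℝ 2 (volume : Measure (Space d × ℝ)) ×
      Lp (Space d) 2 (volume : Measure (Space d × ℝ))) :=
      {p | ‖inner ℝ Y (timeShift (σ * t) p.1) - inner ℝ Y p.1 - t * D‖ ≤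
        (‖Λ₀‖ * (‖p.1 - Z‖ + η) + ‖Λ₁‖ * (‖p.2 - G‖ + η)) * t}
    have hshift : Continuous fun p : Lp ℝ 2 (volume : Measure (Space d × ℝ)) =>
        timeShift (σ * t) p :=
      (isometry_timeShift (σ * t)).continuous
    have hC : IsClosed C := by
      refine isClosed_le ?_ ?_
      · have := hshift.comp
          (continuous_fst (X := Lp ℝ 2 (volume : Measure (Space d × ℝ)))
            (Y := Lp (Space d) 2 (volume : Measure (Space d × ℝ))))
        simp only [Function.comp_def] at this
        fun_prop
      · fun_prop
    have hsub := closure_minimal (t := C) ?_ hC hZ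
    · simp only [C, mem_ofPred_eq, sub_self, norm_zero, zero_add] at hsub
      refine hsub.trans (le_of_eq (by ring))
    · rintro _ ⟨φ, hφ, rfl⟩
      set p := hφ.memLp.toLp φ
      set g := hφ.memLp_gradX.toLp (gradX φ)
      change ‖inner ℝ Y (timeShift (σ * t) p) - inner ℝ Y p - t * D‖ ≤ _
      let J : ℝ → ℝ := fun s => inner ℝ Y (timeShift (σ * s) p) - s * D
      have hJ : ∀ s ∈ Icc 0 t, HasDerivWithinAt J
          ((inner ℝ Λ₀ (timeShift (σ * s) p) + inner ℝ Λ₁ (timeShift (σ * s) g)) - D)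
          (Icc 0 t) s := by
        intro s hs
        have h1 := hasDerivAt_inner_timeShift hφ Y σ s
        rw [h φ hφ s hs.1] at h1
        have e1 : ∫ z, Λ₀ z * φ (z + (0, σ * s)) = inner ℝ Λ₀ (timeShift (σ * s) p) := by
          rw [L2.inner_def]
          refine integral_congr_ae ?_
          filter_upwards [timeShift_toLp (σ * s) hφ.memLp] with z hz
          rw [hz]
          exact mul_comm _ _
        have e2 : ∫ z, inner ℝ (Λ₁ z) (gradX φ (z + (0, σ * s))) =
            inner ℝ Λ₁ (timeShift (σ * s) g) := by
          rw [L2.inner_def]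
          refine integral_congr_ae ?_
          filter_upwards [timeShift_toLp (σ * s) hφ.memLp_gradX] with z hz
          rw [hz]
        rw [e1, e2] at h1
        have h2 := h1.sub ((hasDerivAt_id s).mul_const D)
        rw [one_mul] at h2
        exact h2.hasDerivWithinAt
      have hbound : ∀ s ∈ Ico 0 t,
          ‖(inner ℝ Λ₀ (timeShift (σ * s) p) + inner ℝ Λ₁ (timeShift (σ * s) g)) - D‖ ≤
            ‖Λ₀‖ * (‖p - Z‖ + η) + ‖Λ₁‖ * (‖g - G‖ + η) := by
        intro s hs
        have e : (inner ℝ Λ₀ (timeShift (σ * s) p) + inner ℝ Λ₁ (timeShift (σ * s) g)) - D =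
            inner ℝ Λ₀ ((timeShift (σ * s) p - timeShift (σ * s) Z) + (timeShift (σ * s) Z - Z)) +
            inner ℝ Λ₁ ((timeShift (σ * s) g - timeShift (σ * s) G) +
              (timeShift (σ * s) G - G)) := by
          rw [hD, sub_add_sub_cancel, sub_add_sub_cancel, inner_sub_right, inner_sub_right]
          ring
        have hs' := hη s (Ico_subset_Icc_self hs)
        rw [e]
        refine (norm_add_le _ _).trans (add_le_add ?_ ?_)
        · refine (norm_inner_le_norm _ _).trans (mul_le_mul_of_nonneg_left ?_ (norm_nonneg _))
          refine (norm_add_le _ _).trans (add_le_add (le_of_eq ?_) hs'.1)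
          exact norm_timeShift_sub _ _ _
        · refine (norm_inner_le_norm _ _).trans (mul_le_mul_of_nonneg_left ?_ (norm_nonneg _))
          refine (norm_add_le _ _).trans (add_le_add (le_of_eq ?_) hs'.2)
          exact norm_timeShift_sub _ _ _
      have := norm_image_sub_le_of_norm_deriv_le_segment' hJ hbound t (right_mem_Icc.2 ht)
      simp only [J, mul_zero, timeShift_zero, zero_mul, sub_zero] at this
      rw [sub_right_comm] at this
      exact this
  rw [hasDerivWithinAt_iff_isLittleO, Asymptotics.isLittleO_iff]
  intro c hc
  -- Translations are continuous on `L²`, so the moduli at `Z` and `G` fall below this `η` for short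
  -- times; the remainder is then at most `c t`.
  set η := c / (‖Λ₀‖ + ‖Λ₁‖ + 1) with hη
  have hη0 : 0 < η := by positivity
  have hc1 : Filter.Tendsto (fun s : ℝ => timeShift (σ * s) Z) (𝓝 0) (𝓝 Z) := by
    have := ((continuous_timeShift Z).comp (continuous_const_mul σ)).tendsto 0
    simpa [Function.comp_def, timeShift_zero] using this
  have hc2 : Filter.Tendsto (fun s : ℝ => timeShift (σ * s) G) (𝓝 0) (𝓝 G) := by
    have := ((continuous_timeShift G).comp (continuous_const_mul σ)).tendsto 0
    simpa [Function.comp_def, timeShift_zero] using this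
  obtain ⟨δ, hδ, hδ'⟩ := Metric.eventually_nhds_iff.1
    ((hc1.eventually (Metric.ball_mem_nhds Z hη0)).and
      (hc2.eventually (Metric.ball_mem_nhds G hη0)))
  filter_upwards [self_mem_nhdsWithin, mem_nhdsWithin_of_mem_nhds (Metric.ball_mem_nhds 0 hδ)]
    with t ht htδ
  have ht0 : 0 ≤ t := ht
  have htδ' : t < δ := by simpa [abs_of_nonneg ht0] using htδ
  have h1 := key η t ht0 fun s hs => by
    have := hδ' (y := s) (by simpa [abs_of_nonneg hs.1] using lt_of_le_of_lt hs.2 htδ')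
    exact ⟨by simpa [dist_eq_norm] using this.1.le, by simpa [dist_eq_norm] using this.2.le⟩
  have h2 : (‖Λ₀‖ + ‖Λ₁‖) * η ≤ c := by
    rw [hη, ← mul_div_assoc, div_le_iff₀ (by positivity)]
    nlinarith [norm_nonneg Λ₀, norm_nonneg Λ₁]
  simp only [mul_zero, timeShift_zero, sub_zero, smul_eq_mul]
  rw [Real.norm_of_nonneg ht0]
  exact h1.trans (mul_le_mul_of_nonneg_right h2 ht0)

end Translation

end NullControl

/-! ### Green's formula between forward and backward weak solutions -/

namespace NullControl

variable {d : ℕ}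

/-- Time translation leaves `Q`, so the argument takes place on all of space-time. Test functions on
`Q` vanish outside `Q`, hence extension by zero maps their classes to their classes, and it is
isometric. -/
lemma InL2H10.zeroExt_mem_closure {Q : Set (Space d × ℝ)} (hQ : MeasurableSet Q) {y : L2 Q}
    {g : Lp (Space d) 2 (volume.restrict Q)} (h : InL2H10 Q y g) :
    (zeroExt hQ y, zeroExt hQ g) ∈ closure {p : Lp ℝ 2 (volume : Measure (Space d × ℝ)) ×
      Lp (Space d) 2 (volume : Measure (Space d × ℝ)) |
        ∃ φ, ∃ hφ : IsTest Q φ, p = (hφ.memLp.toLp φ, hφ.memLp_gradX.toLp (gradX φ))} := by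
  have hc : Continuous (Prod.map (zeroExt (F := ℝ) hQ) (zeroExt (F := Space d) hQ)) :=
    (zeroExt hQ).continuous.prodMap (zeroExt hQ).continuous
  refine map_mem_closure (f := Prod.map (zeroExt hQ) (zeroExt hQ)) hc h ?_
  rintro ⟨p, r⟩ ⟨φ, hφ, hp, hr⟩
  exact ⟨φ, hφ, Prod.ext (zeroExt_eq_toLp hQ hφ.memLp (fun _ => hφ.eq_zero) hp)
    (zeroExt_eq_toLp hQ hφ.memLp_gradX (fun _ => hφ.gradX_zero) hr)⟩

namespace IsTest

variable {S : Set (Space d × ℝ)} {φ : Space d × ℝ → ℝ} (hφ : IsTest S φ) (Q : Set (Space d × ℝ))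

/-- The class of a test function in `L²(Q)`. -/
def val : L2 Q := (hφ.memLp.restrict Q).toLp φ

/-- The class of the gradient of a test function in `L²(Q)^d`. -/
def grad : Lp (Space d) 2 (volume.restrict Q) := (hφ.memLp_gradX.restrict Q).toLp (gradX φ)

/-- The class of the time derivative of a test function in `L²(Q)`. -/
def timeDeriv : L2 Q := (hφ.memLp_dt.restrict Q).toLp (dt φ)

lemma val_coeFn : hφ.val Q =ᵐ[volume.restrict Q] φ := (hφ.memLp.restrict Q).coeFn_toLp

lemma grad_coeFn : hφ.grad Q =ᵐ[volume.restrict Q] gradX φ :=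
  (hφ.memLp_gradX.restrict Q).coeFn_toLp

lemma timeDeriv_coeFn : hφ.timeDeriv Q =ᵐ[volume.restrict Q] dt φ :=
  (hφ.memLp_dt.restrict Q).coeFn_toLp

lemma inner_val (y : L2 Q) : inner ℝ y (hφ.val Q) = ∫ z in Q, y z * φ z := by
  rw [L2.inner_def]
  exact integral_congr_ae ((hφ.val_coeFn Q).mono fun z hz => by simp [hz, mul_comm])

lemma inner_timeDeriv (y : L2 Q) : inner ℝ y (hφ.timeDeriv Q) = ∫ z in Q, y z * dt φ z := by
  rw [L2.inner_def]
  exact integral_congr_ae ((hφ.timeDeriv_coeFn Q).mono fun z hz => by simp [hz, mul_comm])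

lemma inner_grad (g : Lp (Space d) 2 (volume.restrict Q)) :
    inner ℝ g (hφ.grad Q) = ∫ z in Q, inner ℝ (g z) (gradX φ z) := by
  rw [L2.inner_def]
  exact integral_congr_ae ((hφ.grad_coeFn Q).mono fun z hz => by simp [hz])

end IsTest

namespace ControlProblem

variable (P : ControlProblem d)

lemma measurableSet_Q : MeasurableSet P.Q := P.Ω_open.measurableSet.prod measurableSet_Ioo

lemma a_memLp : MemLp P.a ⊤ (volume.restrict P.Q) := P.a_mem.1

lemma b_memLp : MemLp P.b ⊤ (volume.restrict P.Q) := P.b_mem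

lemma measurableSet_Qω : MeasurableSet P.Qω := P.ω_open.measurableSet.prod measurableSet_Ioo

lemma Qω_subset_Q : P.Qω ⊆ P.Q := prod_mono P.ω_subset subset_rfl

/-- The bilinear form of the weak formulation, expressed by scalar products in `L²(Q)`. -/
lemma integral_weakForm (σ : ℝ) (y : L2 P.Q) (g : Lp (Space d) 2 (volume.restrict P.Q))
    {S : Set (Space d × ℝ)} {φ : Space d × ℝ → ℝ} (hφ : IsTest S φ) :
    ∫ z in P.Q, (σ * (y z * dt φ z) + P.a z * inner ℝ (g z) (gradX φ z) + P.b z * y z * φ z) =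
      σ * inner ℝ y (hφ.timeDeriv P.Q) + inner ℝ (mulL P.a_memLp g) (hφ.grad P.Q) +
        inner ℝ (mulL P.b_memLp y) (hφ.val P.Q) := by
  rw [← real_inner_smul_right, L2.inner_def, L2.inner_def, L2.inner_def,
    ← integral_add (L2.integrable_inner _ _) (L2.integrable_inner _ _),
    ← integral_add ((L2.integrable_inner _ _).add (L2.integrable_inner _ _))
      (L2.integrable_inner _ _)]
  refine integral_congr_ae ?_
  filter_upwards [mulL_coeFn P.a_memLp g, mulL_coeFn P.b_memLp y, hφ.val_coeFn P.Q,
    hφ.grad_coeFn P.Q, hφ.timeDeriv_coeFn P.Q, Lp.coeFn_smul σ (hφ.timeDeriv P.Q)]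
    with z h1 h2 h3 h4 h5 h6
  simp only [h1, h2, h3, h4, h6, Pi.smul_apply, h5, smul_eq_mul,
    real_inner_smul_left, RCLike.inner_apply, conj_trivial]
  ring

/-- `(y, g)` satisfies the integral identity with the sign `σ` in front of the time derivative and
the right-hand side `l`, for all test functions on `S`. -/
def SatisfiesWeakForm (σ : ℝ) (S : Set (Space d × ℝ)) (l : (Space d × ℝ → ℝ) → ℝ) (y : L2 P.Q)
    (g : Lp (Space d) 2 (volume.restrict P.Q)) : Prop :=
  ∀ φ, IsTest S φ →
    ∫ z in P.Q, (σ * (y z * dt φ z) + P.a z * inner ℝ (g z) (gradX φ z) + P.b z * y z * φ z) = l φ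

/-- The equation reads `-σ ∂_t`-pairing `= ⟨b y - f, φ⟩ + ⟨a g, ∇φ⟩`. The assumption `hS` says that
translating in the direction fixed by `σ` keeps test functions on `Q` admissible: towards earlier
times in the forward problem, towards later times in the backward one. Only `s ≥ 0` is allowed,
whence a one-sided derivative. -/
lemma hasDerivWithinAt_of_satisfiesWeakForm {σ : ℝ} {S : Set (Space d × ℝ)}
    (hS : ∀ s : ℝ, 0 ≤ s → (fun z : Space d × ℝ => z + (0, -σ * s)) ⁻¹' P.Q ⊆ S)
    {f y z : L2 P.Q} {g k : Lp (Space d) 2 (volume.restrict P.Q)}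
    (hy : P.SatisfiesWeakForm σ S (fun φ => ∫ z in P.Q, f z * φ z) y g) (hz : InL2H10 P.Q z k) :
    HasDerivWithinAt (fun s => inner ℝ (zeroExt P.measurableSet_Q y)
        (timeShift (-σ * s) (zeroExt P.measurableSet_Q z)))
      (inner ℝ (mulL P.b_memLp y - f) z + inner ℝ (mulL P.a_memLp g) k) (Ici 0) 0 := by
  have hQ := P.measurableSet_Q
  rw [← (zeroExt hQ).inner_map_map (mulL P.b_memLp y - f) z,
    ← (zeroExt hQ).inner_map_map (mulL P.a_memLp g) k]
  refine hasDerivWithinAt_inner_timeShift (-σ) _ _ _ ?_ (hz.zeroExt_mem_closure hQ)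
  intro φ hφ s hs
  have hφs : IsTest S fun z => φ (z + (0, -σ * s)) := (hφ.comp_add _).mono (hS s hs)
  have h := hy _ hφs
  beta_reduce at h
  rw [P.integral_weakForm σ y g hφs, ← hφs.inner_val P.Q] at h
  have e0 : ∀ (u : L2 P.Q) (f : Space d × ℝ → ℝ),
      ∫ z, zeroExt hQ u z * f z = ∫ z in P.Q, u z * f z := by
    intro u f
    simpa [mul_comm] using integral_inner_zeroExt hQ u f
  rw [e0, e0, integral_inner_zeroExt]
  simp_rw [← gradX_comp_add _ hφ.differentiable, ← dt_comp_add _ hφ.differentiable]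
  rw [← hφs.inner_grad P.Q, ← hφs.inner_val P.Q, inner_sub_left]
  have e1 : ∫ z in P.Q, y z * (-σ * dt (fun z => φ (z + (0, -σ * s))) z) =
      -σ * inner ℝ y (hφs.timeDeriv P.Q) := by
    rw [hφs.inner_timeDeriv, ← integral_const_mul]
    exact integral_congr_ae (.of_forall fun z => by ring)
  rw [e1]
  linarith

/-- Green's formula for a forward and a backward problem with homogeneous data. -/
theorem inner_eq_inner_of_satisfiesWeakForm {f q y z : L2 P.Q}
    {g k : Lp (Space d) 2 (volume.restrict P.Q)} (hyg : InL2H10 P.Q y g)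
    (hy : P.SatisfiesWeakForm (-1) (P.Ω ×ˢ Iio P.T) (fun φ => ∫ z in P.Q, f z * φ z) y g)
    (hzk : InL2H10 P.Q z k)
    (hz : P.SatisfiesWeakForm 1 (P.Ω ×ˢ Ioi 0) (fun φ => ∫ z in P.Q, q z * φ z) z k) :
    inner ℝ y q = inner ℝ f z := by
  have h1 := P.hasDerivWithinAt_of_satisfiesWeakForm (fun s hs x hx => by
    have h := hx.2.2
    simp only [Prod.snd_add] at h
    exact ⟨by simpa using hx.1, by simp only [mem_Iio]; linarith⟩) hy hzk
  have h2 := P.hasDerivWithinAt_of_satisfiesWeakForm (fun s hs x hx => by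
    have h := hx.2.1
    simp only [Prod.snd_add] at h
    exact ⟨by simpa using hx.1, by simp only [mem_Ioi]; linarith⟩) hz hyg
  -- By translation invariance of the measure both one-sided derivatives belong to one function.
  -- Once they are equated, the symmetric terms with `a` and `b` cancel and only the right-hand
  -- sides remain.
  have e : (fun s : ℝ => inner ℝ (zeroExt P.measurableSet_Q y)
      (timeShift (-(-1) * s) (zeroExt P.measurableSet_Q z))) =
      fun s => inner ℝ (zeroExt P.measurableSet_Q z)
        (timeShift (-1 * s) (zeroExt P.measurableSet_Q y)) := by
    ext1 s
    rw [inner_timeShift_right]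
    congr 2
    ring
  rw [e] at h1
  have h3 := (uniqueDiffWithinAt_Ici (0 : ℝ)).eq_deriv _ h1 h2
  rw [inner_sub_left, inner_sub_left, inner_mulL, inner_mulL, real_inner_comm (mulL P.b_memLp z) y,
    real_inner_comm (mulL P.a_memLp k) g, real_inner_comm y q] at h3
  linarith

end ControlProblem

end NullControl

namespace NullControl

variable {d : ℕ}

/-! ### The space `L²(0,T;H¹₀(Ω))` as a closed subspace -/

section EnergySpace

variable (Q S : Set (Space d × ℝ))

/-- The test functions on `S` as elements of `L²(Q)`. -/
def valₗ : testSpace S →ₗ[ℝ] L2 Q where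
  toFun φ := (isTest_coe φ).val Q
  map_add' _ _ := rfl
  map_smul' _ _ := rfl

/-- The gradients of the test functions on `S` as elements of `L²(Q)^d`. -/
def gradₗ : testSpace S →ₗ[ℝ] Lp (Space d) 2 (volume.restrict Q) where
  toFun φ := (isTest_coe φ).grad Q
  map_add' φ ψ := by
    refine (MemLp.toLp_congr _ (((isTest_coe φ).memLp_gradX.restrict Q).add
        ((isTest_coe ψ).memLp_gradX.restrict Q))
      (.of_forall fun z => ?_)).trans (MemLp.toLp_add _ _)
    exact gradX_add (isTest_coe φ).differentiable (isTest_coe ψ).differentiable z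
  map_smul' c φ := by
    refine (MemLp.toLp_congr _ (((isTest_coe φ).memLp_gradX.restrict Q).const_smul c)
      (.of_forall fun z => ?_)).trans (MemLp.toLp_const_smul _ _)
    exact gradX_smul c (isTest_coe φ).differentiable z

/-- The time derivatives of the test functions on `S` as elements of `L²(Q)`. -/
def timeDerivₗ : testSpace S →ₗ[ℝ] L2 Q where
  toFun φ := (isTest_coe φ).timeDeriv Q
  map_add' φ ψ := by
    refine (MemLp.toLp_congr _ (((isTest_coe φ).memLp_dt.restrict Q).add
        ((isTest_coe ψ).memLp_dt.restrict Q))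
      (.of_forall fun z => ?_)).trans (MemLp.toLp_add _ _)
    exact dt_add (isTest_coe φ).differentiable (isTest_coe ψ).differentiable z
  map_smul' c φ := by
    refine (MemLp.toLp_congr _ (((isTest_coe φ).memLp_dt.restrict Q).const_smul c)
      (.of_forall fun z => ?_)).trans (MemLp.toLp_const_smul _ _)
    exact dt_smul c (isTest_coe φ).differentiable z

/-- The Hilbert space `L²(Q) × L²(Q)^d`. -/
abbrev PairSpace : Type := WithLp 2 (L2 Q × Lp (Space d) 2 (volume.restrict Q))

/-- The pairs `(φ, ∇φ)` for test functions on `S`. -/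
def pairₗ : testSpace S →ₗ[ℝ] PairSpace Q :=
  (WithLp.linearEquiv 2 ℝ _).symm.toLinearMap ∘ₗ (valₗ Q S).prod (gradₗ Q S)

/-- `L²(0,T;H¹₀(Ω))` as a closed subspace of `L²(Q) × L²(Q)^d`. -/
def energySpace : Submodule ℝ (PairSpace Q) := (LinearMap.range (pairₗ Q Q)).topologicalClosure

instance : CompleteSpace (energySpace Q) :=
  (Submodule.isClosed_topologicalClosure _).completeSpace_coe

variable {Q S}

lemma inner_pairₗ (u : PairSpace Q) (φ : testSpace S) :
    inner ℝ u (pairₗ Q S φ) = inner ℝ u.fst ((isTest_coe φ).val Q) +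
      inner ℝ u.snd ((isTest_coe φ).grad Q) :=
  WithLp.prod_inner_apply _ _

lemma inL2H10_of_mem_energySpace {u : PairSpace Q} (hu : u ∈ energySpace Q) :
    InL2H10 Q u.fst u.snd := by
  have hu' : u ∈ closure (LinearMap.range (pairₗ Q Q) : Set (PairSpace Q)) := hu
  refine map_mem_closure (f := fun u : PairSpace Q => (u.fst, u.snd))
    (WithLp.prod_continuous_ofLp 2 _ _) hu' ?_
  rintro _ ⟨φ, rfl⟩
  exact ⟨φ, (isTest_coe φ), (isTest_coe φ).val_coeFn Q, (isTest_coe φ).grad_coeFn Q⟩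

/-- Test functions on `Ω × ℝ` belong to `L²(0,T;H¹₀(Ω))`. -/
lemma pairₗ_mem_energySpace {Ω : Set (Space d)} (hΩ : IsOpen Ω) {T : ℝ} (hT : 0 < T)
    (hS : S ⊆ Ω ×ˢ univ) (φ : testSpace S) :
    pairₗ (Ω ×ˢ Ioo 0 T) S φ ∈ energySpace (Ω ×ˢ Ioo 0 T) := by
  set Q := Ω ×ˢ Ioo 0 T with hQdef
  have hQ : MeasurableSet Q := hΩ.measurableSet.prod measurableSet_Ioo
  -- Since the energy space is closed, it is its own double orthogonal, and weak convergence of the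
  -- truncations `θ n * φ` suffices. Cut-offs in time commute with the spatial gradient, so no
  -- derivative of `θ n` appears.
  rw [← Submodule.orthogonal_orthogonal (energySpace Q), Submodule.mem_orthogonal]
  intro u hu
  -- These bumps are centred at `T/2` with both radii increasing to `T/2`. The shift by 2 makes the
  -- inner radius positive at `n = 0`, and the outer radius stays below `T/2`, so that supports are
  -- compact in `(0,T)`.
  let θ : ℕ → ContDiffBump (T / 2) := fun n =>
    { rIn := T / 2 * (1 - 1 / ((n : ℝ) + 2))
      rOut := T / 2 * (1 - 1 / ((n : ℝ) + 3))
      rIn_pos := by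
        have : 1 / ((n : ℝ) + 2) < 1 := by rw [div_lt_one (by positivity)]; linarith
        have : 0 < 1 - 1 / ((n : ℝ) + 2) := by linarith
        positivity
      rIn_lt_rOut := by
        have : 1 / ((n : ℝ) + 3) < 1 / ((n : ℝ) + 2) := by gcongr; norm_num
        gcongr }
  have hθsupp : ∀ n t, t ∈ tsupport (θ n) → t ∈ Ioo 0 T := by
    intro n t ht
    rw [(θ n).tsupport_eq, Metric.mem_closedBall, Real.dist_eq, abs_le] at ht
    have h1 : 0 < 1 / ((n : ℝ) + 3) := by positivity
    have : (θ n).rOut < T / 2 := by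
      change T / 2 * (1 - 1 / ((n : ℝ) + 3)) < T / 2
      nlinarith
    constructor <;> linarith [ht.1, ht.2]
  have hθφ : ∀ n, IsTest Q (fun z => θ n z.2 * φ.1 z) := by
    intro n
    have h1 := (isTest_coe φ).time_mul (θ n).contDiff
    refine ⟨h1.smooth, h1.compact, fun z hz => ⟨(hS (h1.supp hz)).1, hθsupp n _ ?_⟩⟩
    have h2 := tsupport_mul_subset_left (f := fun z : Space d × ℝ => θ n z.2) (g := φ.1) hz
    exact tsupport_comp_subset_preimage (θ n) continuous_snd h2
  have hlim : ∀ z ∈ Q, ∀ᶠ n in Filter.atTop, θ n z.2 = 1 := by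
    intro z hz
    have h1 : Filter.Tendsto (fun n : ℕ => T / 2 * (1 - 1 / ((n : ℝ) + 2))) Filter.atTop
        (𝓝 (T / 2 * (1 - 0))) := by
      refine Filter.Tendsto.const_mul _ (Filter.Tendsto.const_sub _ ?_)
      refine tendsto_const_nhds.div_atTop ?_
      exact Filter.tendsto_atTop_add_const_right _ _ tendsto_natCast_atTop_atTop
    have h2 : |z.2 - T / 2| < T / 2 * (1 - 0) := by
      rw [abs_lt]; constructor <;> linarith [hz.2.1, hz.2.2]
    filter_upwards [h1.eventually_const_lt h2] with n hn
    refine (θ n).one_of_mem_closedBall ?_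
    rw [Metric.mem_closedBall, Real.dist_eq]
    exact hn.le
  have h0 : ∀ n, ∫ z in Q, θ n z.2 * (inner ℝ (u.fst z) ((isTest_coe φ).val Q z) +
      inner ℝ (u.snd z) ((isTest_coe φ).grad Q z)) = 0 := by
    intro n
    have hmem : pairₗ Q Q ⟨_, hθφ n⟩ ∈ energySpace Q :=
      Submodule.le_topologicalClosure _ (LinearMap.mem_range_self _ _)
    have h := (Submodule.mem_orthogonal' _ _).1 hu _ hmem
    rw [inner_pairₗ, L2.inner_def, L2.inner_def,
      ← integral_add (L2.integrable_inner _ _) (L2.integrable_inner _ _)] at h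
    rw [← h]
    refine integral_congr_ae ?_
    filter_upwards [(isTest_coe φ).val_coeFn Q, (isTest_coe φ).grad_coeFn Q,
      IsTest.val_coeFn (hθφ n) Q, IsTest.grad_coeFn (hθφ n) Q] with z h1 h2 h3 h4
    rw [h1, h2, h3, h4, gradX_time_mul _ (isTest_coe φ).differentiable, real_inner_smul_right]
    simp only [RCLike.inner_apply, conj_trivial]
    ring
  have hint : Integrable (fun z => inner ℝ (u.fst z) ((isTest_coe φ).val Q z) +
      inner ℝ (u.snd z) ((isTest_coe φ).grad Q z)) (volume.restrict Q) :=
    (L2.integrable_inner _ _).add (L2.integrable_inner _ _)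
  have ht : Filter.Tendsto (fun n => ∫ z in Q, θ n z.2 *
      (inner ℝ (u.fst z) ((isTest_coe φ).val Q z) +
      inner ℝ (u.snd z) ((isTest_coe φ).grad Q z))) Filter.atTop
      (𝓝 (∫ z in Q, (inner ℝ (u.fst z) ((isTest_coe φ).val Q z) +
      inner ℝ (u.snd z) ((isTest_coe φ).grad Q z)))) := by
    refine tendsto_integral_of_dominated_convergence _ (fun n => ?_) hint.norm (fun n => ?_) ?_
    · exact (((θ n).continuous.comp continuous_snd).aestronglyMeasurable).mul
        hint.aestronglyMeasurable
    · refine .of_forall fun z => ?_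
      rw [norm_mul, Real.norm_of_nonneg (θ n).nonneg]
      exact mul_le_of_le_one_left (norm_nonneg _) (θ n).le_one
    · filter_upwards [ae_restrict_mem hQ] with z hz
      refine tendsto_const_nhds.congr' ?_
      filter_upwards [hlim z hz] with n hn
      rw [hn, one_mul]
  simp_rw [h0] at ht
  rw [inner_pairₗ, L2.inner_def, L2.inner_def,
    ← integral_add (L2.integrable_inner _ _) (L2.integrable_inner _ _)]
  exact tendsto_nhds_unique ht tendsto_const_nhds

end EnergySpace

/-! ### Weighted energy estimate and existence of weak solutions -/

/-- Integration of a time derivative over a cylinder. -/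
lemma setIntegral_timeDeriv {Ω : Set (Space d)} {T : ℝ} (hT : 0 < T)
    {f f' : Space d × ℝ → ℝ} (hf' : Continuous f') (hf'c : HasCompactSupport f')
    (hff' : ∀ x t, HasDerivAt (fun s => f (x, s)) (f' (x, t)) t) :
    ∫ z in Ω ×ˢ Ioo 0 T, f' z = ∫ x in Ω, (f (x, T) - f (x, 0)) := by
  have hint : Integrable f' ((volume : Measure (Space d)).prod (volume : Measure ℝ)) :=
    hf'.integrable_of_hasCompactSupport hf'c (μ := (volume : Measure (Space d × ℝ)))
  rw [Measure.volume_eq_prod, setIntegral_prod _ hint.integrableOn]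
  refine integral_congr_ae (.of_forall fun x => ?_)
  have hc : Continuous fun t => f' (x, t) := hf'.comp (by fun_prop)
  beta_reduce
  rw [← integral_Ioc_eq_integral_Ioo, ← intervalIntegral.integral_of_le hT.le]
  exact intervalIntegral.integral_eq_sub_of_hasDerivAt (fun t _ => hff' x t)
    (hc.intervalIntegrable _ _)

namespace ControlProblem

variable (P : ControlProblem d)

/-- The exponential weight used in the energy estimate. -/
def expWeight (μ t : ℝ) : ℝ := Real.exp (μ * t)

lemma contDiff_expWeight (μ : ℝ) : ContDiff ℝ ((⊤ : ℕ∞) : WithTop ℕ∞) (expWeight μ) :=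
  Real.contDiff_exp.comp (contDiff_const.mul contDiff_id)

lemma hasDerivAt_expWeight_mul_sq {φ : Space d × ℝ → ℝ} (hφ : Differentiable ℝ φ) (μ : ℝ)
    (x : Space d) (t : ℝ) : HasDerivAt (fun s => expWeight μ s * φ (x, s) ^ 2)
      (μ * (expWeight μ t * φ (x, t) ^ 2) + 2 * (expWeight μ t * φ (x, t) * dt φ (x, t))) t := by
  have h1 : HasDerivAt (fun s => φ (x, s)) (dt φ (x, t)) t := by
    rw [dt_eq hφ]
    exact hasDerivAt_slice_time hφ x t
  have h2 : HasDerivAt (expWeight μ) (expWeight μ t * μ) t := by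
    have := ((hasDerivAt_id t).const_mul μ).exp
    rw [mul_one] at this
    exact this
  refine (h2.mul (h1.pow 2)).congr_deriv ?_
  simp only [Nat.cast_ofNat, Pi.pow_apply]
  ring

/-- Energy identity for the time derivative with an exponential weight. -/
lemma setIntegral_expWeight_mul_dt {S : Set (Space d × ℝ)} {φ : Space d × ℝ → ℝ}
    (hφ : IsTest S φ) (μ : ℝ) :
    ∫ z in P.Q, expWeight μ z.2 * φ z * dt φ z =
      1 / 2 * (∫ x in P.Ω, (expWeight μ P.T * φ (x, P.T) ^ 2 - φ (x, 0) ^ 2)) -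
        μ / 2 * ∫ z in P.Q, expWeight μ z.2 * φ z ^ 2 := by
  have hw : Continuous fun z : Space d × ℝ => expWeight μ z.2 :=
    (contDiff_expWeight μ).continuous.comp continuous_snd
  have k1 : Continuous fun z => expWeight μ z.2 * φ z * dt φ z :=
    (hw.mul hφ.continuous).mul hφ.continuous_dt
  have k2 : Continuous fun z => expWeight μ z.2 * φ z ^ 2 := hw.mul (hφ.continuous.pow 2)
  have c1 : HasCompactSupport fun z => expWeight μ z.2 * φ z * dt φ z :=
    HasCompactSupport.mul_left hφ.hasCompactSupport_dt
  have c2 : HasCompactSupport fun z => expWeight μ z.2 * φ z ^ 2 := by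
    simp_rw [pow_two]
    exact HasCompactSupport.mul_left (HasCompactSupport.mul_left hφ.compact)
  have i1 : Integrable (fun z => expWeight μ z.2 * φ z * dt φ z) (volume.restrict P.Q) :=
    (k1.integrable_of_hasCompactSupport c1).integrableOn
  have i2 : Integrable (fun z => expWeight μ z.2 * φ z ^ 2) (volume.restrict P.Q) :=
    (k2.integrable_of_hasCompactSupport c2).integrableOn
  have c2' : HasCompactSupport fun z => μ * (expWeight μ z.2 * φ z ^ 2) :=
    HasCompactSupport.mul_left c2
  have c1' : HasCompactSupport fun z => 2 * (expWeight μ z.2 * φ z * dt φ z) :=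
    HasCompactSupport.mul_left c1
  have c3 := c2'.add c1'
  have h := setIntegral_timeDeriv (Ω := P.Ω) P.T_pos
    (f := fun z : Space d × ℝ => expWeight μ z.2 * φ z ^ 2)
    (f' := (fun z : Space d × ℝ => μ * (expWeight μ z.2 * φ z ^ 2)) +
      fun z : Space d × ℝ => 2 * (expWeight μ z.2 * φ z * dt φ z))
    ((k2.const_mul μ).add (k1.const_mul 2))
    c3
    (hasDerivAt_expWeight_mul_sq hφ.differentiable μ)
  rw [integral_add' (i2.const_mul μ) (i1.const_mul 2), integral_const_mul,
    integral_const_mul] at h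
  have e0 : expWeight μ 0 = 1 := by simp [expWeight]
  simp only [e0, one_mul] at h
  rw [← h]
  ring

end ControlProblem

end NullControl

namespace NullControl

variable {d : ℕ}

lemma exists_ae_norm_le {X : Type*} [MeasurableSpace X] {μ : Measure X} {m : X → ℝ}
    (hm : MemLp m ⊤ μ) : ∃ B : ℝ, 0 ≤ B ∧ ∀ᵐ x ∂μ, |m x| ≤ B := by
  refine ⟨(eLpNorm m ⊤ μ).toReal, ENNReal.toReal_nonneg, ?_⟩
  filter_upwards [ae_le_eLpNormEssSup (f := m) (μ := μ)] with x hx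
  rw [← eLpNorm_exponent_top] at hx
  have := ENNReal.toReal_mono hm.2.ne hx
  rwa [toReal_enorm, Real.norm_eq_abs] at this

namespace ControlProblem

variable (P : ControlProblem d)

lemma weighted_isTest {S : Set (Space d × ℝ)} {φ : Space d × ℝ → ℝ} (hφ : IsTest S φ) (μ : ℝ) :
    IsTest S (fun z => expWeight μ z.2 * φ z) :=
  hφ.time_mul (contDiff_expWeight μ)

lemma expWeight_pos (μ t : ℝ) : 0 < expWeight μ t := Real.exp_pos _

lemma expWeight_bounds (μ : ℝ) {t : ℝ} (ht : t ∈ Ioo 0 P.T) :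
    Real.exp (-(|μ| * P.T)) ≤ expWeight μ t ∧ expWeight μ t ≤ Real.exp (|μ| * P.T) := by
  have h1 : |μ * t| ≤ |μ| * P.T := by
    rw [abs_mul, abs_of_pos ht.1]
    exact mul_le_mul_of_nonneg_left ht.2.le (abs_nonneg _)
  exact ⟨Real.exp_le_exp.2 (abs_le.1 h1).1, Real.exp_le_exp.2 (abs_le.1 h1).2⟩

lemma val_weighted_coeFn {S : Set (Space d × ℝ)} {φ : Space d × ℝ → ℝ} (hφ : IsTest S φ) (μ : ℝ) :
    (weighted_isTest hφ μ).val P.Q =ᵐ[volume.restrict P.Q]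
      fun z => expWeight μ z.2 * hφ.val P.Q z := by
  filter_upwards [(weighted_isTest hφ μ).val_coeFn P.Q, hφ.val_coeFn P.Q] with z h1 h2
  rw [h1, h2]

lemma grad_weighted_coeFn {S : Set (Space d × ℝ)} {φ : Space d × ℝ → ℝ} (hφ : IsTest S φ) (μ : ℝ) :
    (weighted_isTest hφ μ).grad P.Q =ᵐ[volume.restrict P.Q]
      fun z => expWeight μ z.2 • hφ.grad P.Q z := by
  filter_upwards [(weighted_isTest hφ μ).grad_coeFn P.Q, hφ.grad_coeFn P.Q] with z h1 h2
  rw [h1, h2, gradX_time_mul _ hφ.differentiable]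

lemma norm_pairₗ_weighted_le {S : Set (Space d × ℝ)} (φ : testSpace S) (μ : ℝ) :
    ‖pairₗ P.Q S ⟨_, weighted_isTest (isTest_coe φ) μ⟩‖ ≤
      Real.exp (|μ| * P.T) * ‖pairₗ P.Q S φ‖ := by
  have h1 : ‖(weighted_isTest (isTest_coe φ) μ).val P.Q‖ ≤
      Real.exp (|μ| * P.T) * ‖(isTest_coe φ).val P.Q‖ := by
    refine Lp.norm_le_mul_norm_of_ae_le_mul ?_
    filter_upwards [P.val_weighted_coeFn (isTest_coe φ) μ,
      ae_restrict_mem P.measurableSet_Q] with z hz hzQ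
    rw [hz, norm_mul, Real.norm_of_nonneg (expWeight_pos μ z.2).le]
    exact mul_le_mul_of_nonneg_right (P.expWeight_bounds μ hzQ.2).2 (norm_nonneg _)
  have h2 : ‖(weighted_isTest (isTest_coe φ) μ).grad P.Q‖ ≤
      Real.exp (|μ| * P.T) * ‖(isTest_coe φ).grad P.Q‖ := by
    refine Lp.norm_le_mul_norm_of_ae_le_mul ?_
    filter_upwards [P.grad_weighted_coeFn (isTest_coe φ) μ,
      ae_restrict_mem P.measurableSet_Q] with z hz hzQ
    rw [hz, norm_smul, Real.norm_of_nonneg (expWeight_pos μ z.2).le]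
    exact mul_le_mul_of_nonneg_right (P.expWeight_bounds μ hzQ.2).2 (norm_nonneg _)
  refine le_of_sq_le_sq ?_ (by positivity)
  rw [mul_pow, WithLp.prod_norm_sq_eq_of_L2, WithLp.prod_norm_sq_eq_of_L2, mul_add, ← mul_pow,
    ← mul_pow]
  exact add_le_add (pow_le_pow_left₀ (norm_nonneg _) h1 2) (pow_le_pow_left₀ (norm_nonneg _) h2 2)

/-- The operator representing the weak form: `⟪(y,g), K φ⟫` is the left-hand side of the integral
identity with the test function `φ`. -/
def weakFormₗ (σ : ℝ) (S : Set (Space d × ℝ)) : testSpace S →ₗ[ℝ] PairSpace P.Q :=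
  (WithLp.linearEquiv 2 ℝ _).symm.toLinearMap ∘ₗ
    (σ • timeDerivₗ P.Q S + (mulL P.b_memLp).toLinearMap ∘ₗ valₗ P.Q S).prod
      ((mulL P.a_memLp).toLinearMap ∘ₗ gradₗ P.Q S)

lemma inner_weakFormₗ (σ : ℝ) {S : Set (Space d × ℝ)} (u : PairSpace P.Q) (φ : testSpace S) :
    inner ℝ u (P.weakFormₗ σ S φ) =
      σ * inner ℝ u.fst ((isTest_coe φ).timeDeriv P.Q) +
        inner ℝ (mulL P.a_memLp u.snd) ((isTest_coe φ).grad P.Q) +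
        inner ℝ (mulL P.b_memLp u.fst) ((isTest_coe φ).val P.Q) := by
  rw [inner_mulL, inner_mulL, ← real_inner_smul_right, add_right_comm, ← inner_add_right]
  exact WithLp.prod_inner_apply _ _

/-- The boundary terms in the weighted energy identity. -/
def boundaryTerm (σ μ : ℝ) (φ : Space d × ℝ → ℝ) : ℝ :=
  σ * ∫ x in P.Ω, (expWeight μ P.T * φ (x, P.T) ^ 2 - φ (x, 0) ^ 2)

lemma mul_norm_sq_le_inner_weighted {F : Type*} [NormedAddCommGroup F] [InnerProductSpace ℝ F]
    {Q : Set (Space d × ℝ)} {u v : Lp F 2 (volume.restrict Q)} {m : Space d × ℝ → ℝ} {c : ℝ}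
    (hv : v =ᵐ[volume.restrict Q] fun z => m z • u z) (hm : ∀ᵐ z ∂volume.restrict Q, c ≤ m z) :
    c * ‖u‖ ^ 2 ≤ inner ℝ v u := by
  rw [← real_inner_self_eq_norm_sq, ← real_inner_smul_left, L2.inner_def, L2.inner_def]
  refine integral_mono_ae (L2.integrable_inner _ _) (L2.integrable_inner _ _) ?_
  filter_upwards [hv, hm, Lp.coeFn_smul c u] with z h1 h2 h3
  rw [h1, h3, Pi.smul_apply, real_inner_smul_left, real_inner_smul_left]
  exact mul_le_mul_of_nonneg_right h2 real_inner_self_nonneg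

/-- The weighted energy estimate. -/
lemma exists_energy_estimate {σ : ℝ} (hσ : σ * σ = 1) :
    ∃ μ c : ℝ, 0 < c ∧ ∀ (S : Set (Space d × ℝ)) (φ : testSpace S),
      c * ‖pairₗ P.Q S φ‖ ^ 2 + 1 / 2 * P.boundaryTerm σ μ φ.1 ≤
        inner ℝ (pairₗ P.Q S ⟨_, weighted_isTest (isTest_coe φ) μ⟩) (P.weakFormₗ σ S φ) := by
  obtain ⟨B, hB, hBb⟩ := exists_ae_norm_le P.b_memLp
  set l : ℝ := P.a₀ + B
  -- With this `μ`, differentiating the weight produces the zero-order term `l ∫ e^{μt} φ²`. Since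
  -- `l + b ≥ a₀`, it absorbs a potential of any sign and leaves the same coercivity constant for
  -- `φ` as for `∇φ`.
  set μ : ℝ := -(2 * σ * l) with hμ
  set m := Real.exp (-(|μ| * P.T))
  have hm : 0 < m := Real.exp_pos _
  have ha₀ := P.a₀_pos
  refine ⟨μ, P.a₀ * m, by positivity, fun S φ => ?_⟩
  have hψ := weighted_isTest (isTest_coe φ) μ
  rw [inner_weakFormₗ]
  change _ ≤ σ * inner ℝ (hψ.val P.Q) _ + inner ℝ (mulL P.a_memLp (hψ.grad P.Q)) _ +
    inner ℝ (mulL P.b_memLp (hψ.val P.Q)) _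
  have hw : ∀ᵐ z ∂volume.restrict P.Q, m ≤ expWeight μ z.2 := by
    filter_upwards [ae_restrict_mem P.measurableSet_Q] with z hz
    exact (P.expWeight_bounds μ hz.2).1
  have e1 : inner ℝ (hψ.val P.Q) ((isTest_coe φ).timeDeriv P.Q) =
      1 / 2 * (∫ x in P.Ω, (expWeight μ P.T * φ.1 (x, P.T) ^ 2 - φ.1 (x, 0) ^ 2)) -
        μ / 2 * inner ℝ (hψ.val P.Q) ((isTest_coe φ).val P.Q) := by
    rw [IsTest.inner_timeDeriv, IsTest.inner_val]
    have h := P.setIntegral_expWeight_mul_dt (isTest_coe φ) μ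
    have h1 : ∫ z in P.Q, hψ.val P.Q z * dt φ.1 z =
        ∫ z in P.Q, expWeight μ z.2 * φ.1 z * dt φ.1 z :=
      integral_congr_ae ((hψ.val_coeFn P.Q).mono fun z hz => by simp only [hz])
    have h2 : ∫ z in P.Q, hψ.val P.Q z * φ.1 z = ∫ z in P.Q, expWeight μ z.2 * φ.1 z ^ 2 :=
      integral_congr_ae ((hψ.val_coeFn P.Q).mono fun z hz => by simp only [hz]; ring)
    rw [h1, h2, h]
  have e2 : P.a₀ * m * ‖(isTest_coe φ).grad P.Q‖ ^ 2 ≤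
      inner ℝ (mulL P.a_memLp (hψ.grad P.Q)) ((isTest_coe φ).grad P.Q) := by
    refine mul_norm_sq_le_inner_weighted (m := fun z => P.a z * expWeight μ z.2) ?_ ?_
    · filter_upwards [mulL_coeFn P.a_memLp (hψ.grad P.Q),
        P.grad_weighted_coeFn (isTest_coe φ) μ] with z h1 h2
      rw [h1, h2, smul_smul]
    · filter_upwards [hw, P.a_ge] with z h1 h2
      exact mul_le_mul h2 h1 hm.le (ha₀.le.trans h2)
  have e3 : P.a₀ * m * ‖(isTest_coe φ).val P.Q‖ ^ 2 ≤
      inner ℝ (l • hψ.val P.Q + mulL P.b_memLp (hψ.val P.Q)) ((isTest_coe φ).val P.Q) := by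
    refine mul_norm_sq_le_inner_weighted (m := fun z => (l + P.b z) * expWeight μ z.2) ?_ ?_
    · filter_upwards [mulL_coeFn P.b_memLp (hψ.val P.Q), P.val_weighted_coeFn (isTest_coe φ) μ,
        Lp.coeFn_add (l • hψ.val P.Q) (mulL P.b_memLp (hψ.val P.Q)),
        Lp.coeFn_smul l (hψ.val P.Q)] with z h1 h2 h3 h4
      rw [h3, Pi.add_apply, h4, Pi.smul_apply, h1, h2]
      simp only [smul_eq_mul]
      ring
    · filter_upwards [hw, hBb] with z h1 h2
      have : P.a₀ ≤ l + P.b z := by linarith [(abs_le.1 h2).1]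
      exact mul_le_mul this h1 hm.le (ha₀.le.trans this)
  rw [inner_add_left, real_inner_smul_left] at e3
  have e4 : ‖pairₗ P.Q S φ‖ ^ 2 =
      ‖(isTest_coe φ).val P.Q‖ ^ 2 + ‖(isTest_coe φ).grad P.Q‖ ^ 2 :=
    WithLp.prod_norm_sq_eq_of_L2 _
  have e5 : σ * (μ / 2) = -l := by
    rw [hμ]; linear_combination (-l) * hσ
  rw [e1, e4, boundaryTerm]
  linear_combination e2 + e3 + (inner ℝ (hψ.val P.Q) ((isTest_coe φ).val P.Q)) * e5

/-- Existence of weak solutions for right-hand sides controlled by the energy norm and the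
boundary terms. -/
theorem exists_weak_solution {σ : ℝ} (hσ : σ * σ = 1) {S : Set (Space d × ℝ)}
    (hS : S ⊆ P.Ω ×ˢ univ) (l : testSpace S →ₗ[ℝ] ℝ) {C : ℝ} (hC : 0 ≤ C)
    (hl : ∀ (μ : ℝ) (φ : testSpace S), 0 ≤ P.boundaryTerm σ μ φ.1 ∧
      l φ ^ 2 ≤ C ^ 2 * (‖pairₗ P.Q S φ‖ ^ 2 + P.boundaryTerm σ μ φ.1)) :
    ∃ y g, InL2H10 P.Q y g ∧ ∀ φ : testSpace S,
      ∫ z in P.Q, (σ * (y z * dt φ.1 z) + P.a z * inner ℝ (g z) (gradX φ.1 z) +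
        P.b z * y z * φ.1 z) = l φ := by
  -- The exponent is fixed only here by the energy estimate, which is why `hl` is required for every
  -- `μ`.
  obtain ⟨μ, c, hc, hE⟩ := P.exists_energy_estimate hσ
  set M := Real.exp (|μ| * P.T)
  have hM : 0 < M := Real.exp_pos _
  set k := min c (1 / 2) with hk
  have hk0 : 0 < k := lt_min hc (by norm_num)
  obtain ⟨u, hu, hul⟩ := exists_mem_forall_inner_eq (energySpace P.Q) (P.weakFormₗ σ S) l
    (C * (M / k)) (fun φ => by
      obtain ⟨hb, hlφ⟩ := hl μ φ
      set N := ‖pairₗ P.Q S φ‖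
      set b := P.boundaryTerm σ μ φ.1
      set n := Real.sqrt (N ^ 2 + b)
      have hn2 : n ^ 2 = N ^ 2 + b := Real.sq_sqrt (by positivity)
      have hNn : N ≤ n := Real.le_sqrt_of_sq_le (by linarith)
      -- Weighted test functions on `S` need not vanish at both ends of `(0,T)`, yet they lie in the
      -- energy space. Hence only the projection of `K φ` enters the estimate, as Lions' theorem
      -- demands.
      have hmem := pairₗ_mem_energySpace P.Ω_open P.T_pos hS ⟨_, weighted_isTest (isTest_coe φ) μ⟩
      set p := ‖(energySpace P.Q).starProjection (P.weakFormₗ σ S φ)‖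
      have h1 : inner ℝ (pairₗ P.Q S ⟨_, weighted_isTest (isTest_coe φ) μ⟩) (P.weakFormₗ σ S φ) ≤
          M * N * p := by
        rw [← Submodule.starProjection_eq_self_iff.2 hmem,
          Submodule.inner_starProjection_left_eq_right]
        exact (real_inner_le_norm _ _).trans
          (mul_le_mul_of_nonneg_right (P.norm_pairₗ_weighted_le φ μ) (norm_nonneg _))
      -- The quantity `n` joins the energy norm and the boundary term, so one factor `n` cancels and
      -- the boundary term is controlled as well.
      have h2 : k * n ^ 2 ≤ M * n * p := by
        calc k * n ^ 2 = k * N ^ 2 + k * b := by rw [hn2]; ring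
          _ ≤ c * N ^ 2 + 1 / 2 * b := add_le_add
            (mul_le_mul_of_nonneg_right (min_le_left _ _) (sq_nonneg _))
            (mul_le_mul_of_nonneg_right (min_le_right _ _) hb)
          _ ≤ M * N * p := (hE S φ).trans h1
          _ ≤ M * n * p := by
            have : 0 ≤ p := norm_nonneg _
            gcongr
      have h3 : n ≤ M / k * p := by
        rcases (Real.sqrt_nonneg (N ^ 2 + b)).eq_or_lt with h0 | h0
        · rw [show n = 0 from h0.symm]
          have : 0 ≤ p := norm_nonneg _
          positivity
        · have h0' : 0 < n := h0
          rw [div_mul_eq_mul_div, le_div_iff₀ hk0]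
          refine le_of_mul_le_mul_right ?_ h0'
          linarith
      calc |l φ| ≤ C * n := by
            refine abs_le_of_sq_le_sq ?_ (by positivity)
            rw [mul_pow, hn2]
            exact hlφ
        _ ≤ C * (M / k * p) := by gcongr
        _ = _ := by ring)
  refine ⟨u.fst, u.snd, inL2H10_of_mem_energySpace hu, fun φ => ?_⟩
  rw [P.integral_weakForm σ u.fst u.snd (isTest_coe φ), ← hul φ, inner_weakFormₗ]

end ControlProblem

end NullControl

/-! ### Well-posedness of both problems and adjointness of `M` and `M*` -/

namespace NullControl

variable {d : ℕ}

lemma IsTest.memLp_slice {S : Set (Space d × ℝ)} {φ : Space d × ℝ → ℝ} (hφ : IsTest S φ) (t : ℝ)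
    (Ω : Set (Space d)) : MemLp (fun x => φ (x, t)) 2 (volume.restrict Ω) := by
  have hc : HasCompactSupport fun x => φ (x, t) :=
    hφ.compact.comp_isClosedEmbedding
      (Function.LeftInverse.isClosedEmbedding (f := Prod.fst) (g := fun x : Space d => (x, t))
        (fun _ => rfl) continuous_fst (by fun_prop))
  exact ((hφ.continuous.comp (by fun_prop)).memLp_of_hasCompactSupport hc).restrict Ω

/-- The trace at the initial time of test functions. -/
def initialTraceₗ (Ω : Set (Space d)) (S : Set (Space d × ℝ)) : testSpace S →ₗ[ℝ] L2 Ω where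
  toFun φ := ((isTest_coe φ).memLp_slice 0 Ω).toLp _
  map_add' _ _ := rfl
  map_smul' _ _ := rfl

lemma initialTraceₗ_coeFn (Ω : Set (Space d)) {S : Set (Space d × ℝ)} (φ : testSpace S) :
    initialTraceₗ Ω S φ =ᵐ[volume.restrict Ω] fun x => φ.1 (x, 0) :=
  MemLp.coeFn_toLp ((isTest_coe φ).memLp_slice 0 Ω)

lemma norm_val_le {Q S : Set (Space d × ℝ)} (φ : testSpace S) :
    ‖(isTest_coe φ).val Q‖ ≤ ‖pairₗ Q S φ‖ := by
  refine le_of_sq_le_sq ?_ (norm_nonneg _)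
  rw [WithLp.prod_norm_sq_eq_of_L2]
  exact le_add_of_nonneg_right (sq_nonneg _)

lemma InL2H10.sub {Q : Set (Space d × ℝ)} {y y' : L2 Q} {g g' : Lp (Space d) 2 (volume.restrict Q)}
    (h : InL2H10 Q y g) (h' : InL2H10 Q y' g') : InL2H10 Q (y - y') (g - g') := by
  refine map_mem_closure₂ (f := fun p r : L2 Q × Lp (Space d) 2 (volume.restrict Q) => p - r)
    continuous_sub h h' ?_
  rintro p ⟨φ, hφ, hp1, hp2⟩ r ⟨ψ, hψ, hr1, hr2⟩
  refine ⟨φ + (-1 : ℝ) • ψ, hφ.add (hψ.smul _), ?_, ?_⟩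
  · filter_upwards [hp1, hr1, Lp.coeFn_sub p.1 r.1] with z h1 h2 h3
    rw [Prod.fst_sub, h3, Pi.sub_apply, h1, h2]
    simp [sub_eq_add_neg]
  · filter_upwards [hp2, hr2, Lp.coeFn_sub p.2 r.2] with z h1 h2 h3
    rw [Prod.snd_sub, h3, Pi.sub_apply, h1, h2, gradX_add hφ.differentiable
      (hψ.smul _).differentiable, gradX_smul _ hψ.differentiable]
    simp [sub_eq_add_neg]

namespace ControlProblem

variable (P : ControlProblem d)

lemma isForwardSolution_iff {f : Space d × ℝ → ℝ} {y₀ : L2 P.Ω} {y : L2 P.Q} :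
    P.IsForwardSolution f y₀ y ↔ ∃ g, InL2H10 P.Q y g ∧
      P.SatisfiesWeakForm (-1) (P.Ω ×ˢ Iio P.T)
        (fun φ => (∫ z in P.Q, f z * φ z) + ∫ x in P.Ω, y₀ x * φ (x, 0)) y g := by
  simp only [IsForwardSolution, SatisfiesWeakForm, neg_one_mul]

lemma isBackwardSolution_iff {q z : L2 P.Q} :
    P.IsBackwardSolution q z ↔ ∃ g, InL2H10 P.Q z g ∧
      P.SatisfiesWeakForm 1 (P.Ω ×ˢ Ioi 0) (fun φ => ∫ s in P.Q, q s * φ s) z g := by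
  simp only [IsBackwardSolution, SatisfiesWeakForm, one_mul]

theorem exists_isForwardSolution {f : Space d × ℝ → ℝ} (hf : MemLp f 2 (volume.restrict P.Q))
    (y₀ : L2 P.Ω) : ∃ y, P.IsForwardSolution f y₀ y := by
  set S := P.Ω ×ˢ Iio P.T
  set F : L2 P.Q := hf.toLp f
  let l : testSpace S →ₗ[ℝ] ℝ :=
    (innerₗ (L2 P.Q) F) ∘ₗ valₗ P.Q S + (innerₗ (L2 P.Ω) y₀) ∘ₗ initialTraceₗ P.Ω S
  have hl : ∀ φ, l φ = inner ℝ F ((isTest_coe φ).val P.Q) + inner ℝ y₀ (initialTraceₗ P.Ω S φ) :=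
    fun _ => rfl
  -- Test functions vanish at `t = T` and the weight equals 1 at `t = 0`, so the boundary term is
  -- exactly the initial trace, whatever `μ`. This is what controls the initial datum in `l`.
  have hb : ∀ (μ : ℝ) (φ : testSpace S),
      P.boundaryTerm (-1) μ φ.1 = ‖initialTraceₗ P.Ω S φ‖ ^ 2 := by
    intro μ φ
    rw [boundaryTerm, norm_sq_eq_integral, neg_one_mul, ← integral_neg]
    refine integral_congr_ae ?_
    filter_upwards [initialTraceₗ_coeFn P.Ω φ] with x hx
    rw [hx, (isTest_coe φ).eq_zero (z := (x, P.T))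
      (fun h => lt_irrefl _ (mem_Iio.1 (mem_prod.1 h).2))]
    ring
  obtain ⟨y, g, hyg, hy⟩ := P.exists_weak_solution (σ := -1) (by norm_num)
    (prod_mono subset_rfl (subset_univ _)) l (Real.sqrt_nonneg (‖F‖ ^ 2 + ‖y₀‖ ^ 2))
    (fun μ φ => by
      rw [hb, Real.sq_sqrt (by positivity)]
      refine ⟨sq_nonneg _, ?_⟩
      have h1 : |l φ| ≤ ‖F‖ * ‖pairₗ P.Q S φ‖ + ‖y₀‖ * ‖initialTraceₗ P.Ω S φ‖ := by
        rw [hl]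
        refine (abs_add_le _ _).trans (add_le_add ?_ (abs_real_inner_le_norm _ _))
        exact (abs_real_inner_le_norm _ _).trans
          (mul_le_mul_of_nonneg_left (norm_val_le φ) (norm_nonneg _))
      calc l φ ^ 2 = |l φ| ^ 2 := (sq_abs _).symm
        _ ≤ (‖F‖ * ‖pairₗ P.Q S φ‖ + ‖y₀‖ * ‖initialTraceₗ P.Ω S φ‖) ^ 2 :=
          pow_le_pow_left₀ (abs_nonneg _) h1 2
        _ ≤ _ := by
          -- Cauchy–Schwarz in the plane: the hinted square is the difference in Lagrange's
          -- identity.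
          nlinarith [sq_nonneg (‖F‖ * ‖initialTraceₗ P.Ω S φ‖ - ‖y₀‖ * ‖pairₗ P.Q S φ‖)])
  refine ⟨y, P.isForwardSolution_iff.2 ⟨g, hyg, fun φ hφ => ?_⟩⟩
  rw [hy ⟨φ, hφ⟩, hl, IsTest.inner_val, L2.inner_def]
  congr 1
  · exact integral_congr_ae (hf.coeFn_toLp.mono fun z hz => by simp only [F, hz])
  · refine integral_congr_ae ((initialTraceₗ_coeFn P.Ω ⟨φ, hφ⟩).mono fun x hx => ?_)
    beta_reduce at hx ⊢
    rw [hx]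
    exact mul_comm _ _

theorem exists_isBackwardSolution (q : L2 P.Q) : ∃ z, P.IsBackwardSolution q z := by
  set S := P.Ω ×ˢ Ioi (0 : ℝ)
  let l : testSpace S →ₗ[ℝ] ℝ := (innerₗ (L2 P.Q) q) ∘ₗ valₗ P.Q S
  have hl : ∀ φ, l φ = inner ℝ q ((isTest_coe φ).val P.Q) := fun _ => rfl
  -- Here test functions vanish at `t = 0`, and the trace at `t = T` enters with a positive sign.
  have hb : ∀ (μ : ℝ) (φ : testSpace S), 0 ≤ P.boundaryTerm 1 μ φ.1 := by
    intro μ φ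
    rw [boundaryTerm, one_mul]
    refine integral_nonneg fun x => ?_
    rw [(isTest_coe φ).eq_zero (z := (x, 0)) (fun h => lt_irrefl _ (mem_Ioi.1 (mem_prod.1 h).2))]
    rw [zero_pow two_ne_zero, sub_zero]
    exact mul_nonneg (expWeight_pos μ P.T).le (sq_nonneg _)
  obtain ⟨z, g, hzg, hz⟩ := P.exists_weak_solution (σ := 1) (by norm_num)
    (prod_mono subset_rfl (subset_univ _)) l (norm_nonneg q) (fun μ φ => by
      refine ⟨hb μ φ, ?_⟩
      have h1 : |l φ| ≤ ‖q‖ * ‖pairₗ P.Q S φ‖ := (abs_real_inner_le_norm _ _).trans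
        (mul_le_mul_of_nonneg_left (norm_val_le φ) (norm_nonneg _))
      calc l φ ^ 2 = |l φ| ^ 2 := (sq_abs _).symm
        _ ≤ (‖q‖ * ‖pairₗ P.Q S φ‖) ^ 2 := pow_le_pow_left₀ (abs_nonneg _) h1 2
        _ ≤ _ := by
          rw [mul_pow]
          exact mul_le_mul_of_nonneg_left (le_add_of_nonneg_right (hb μ φ)) (sq_nonneg _))
  refine ⟨z, P.isBackwardSolution_iff.2 ⟨g, hzg, fun φ hφ => ?_⟩⟩
  rw [hz ⟨φ, hφ⟩, hl, IsTest.inner_val]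

/-- Green's formula for weak solutions. -/
theorem inner_eq_inner_of_solutions {f : Space d × ℝ → ℝ} (hf : MemLp f 2 (volume.restrict P.Q))
    {q y z : L2 P.Q} (hy : P.IsForwardSolution f 0 y) (hz : P.IsBackwardSolution q z) :
    inner ℝ y q = inner ℝ (hf.toLp f) z := by
  obtain ⟨g, hyg, hy⟩ := P.isForwardSolution_iff.1 hy
  obtain ⟨k, hzk, hz⟩ := P.isBackwardSolution_iff.1 hz
  refine P.inner_eq_inner_of_satisfiesWeakForm hyg (fun φ hφ => ?_) hzk hz
  rw [hy φ hφ]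
  have h0 : ∫ x in P.Ω, (0 : L2 P.Ω) x * φ (x, 0) = 0 := by
    rw [← integral_zero (Space d) ℝ (μ := volume.restrict P.Ω)]
    refine integral_congr_ae ?_
    filter_upwards [Lp.coeFn_zero ℝ 2 (volume.restrict P.Ω)] with x hx
    rw [hx, Pi.zero_apply, zero_mul]
  beta_reduce
  rw [h0, add_zero]
  exact integral_congr_ae (hf.coeFn_toLp.mono fun z hz => by simp only [hz])

lemma SatisfiesWeakForm.sub {σ : ℝ} {S : Set (Space d × ℝ)} {l l' : (Space d × ℝ → ℝ) → ℝ}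
    {y y' : L2 P.Q} {g g' : Lp (Space d) 2 (volume.restrict P.Q)}
    (h : P.SatisfiesWeakForm σ S l y g) (h' : P.SatisfiesWeakForm σ S l' y' g') :
    P.SatisfiesWeakForm σ S (fun φ => l φ - l' φ) (y - y') (g - g') := by
  intro φ hφ
  beta_reduce
  rw [← h φ hφ, ← h' φ hφ, P.integral_weakForm _ _ _ hφ, P.integral_weakForm _ _ _ hφ,
    P.integral_weakForm _ _ _ hφ, map_sub, map_sub, inner_sub_left, inner_sub_left, inner_sub_left]
  ring

/-- Uniqueness by duality: the difference of two solutions has zero data, and Green's formula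
against the backward solution with that difference as source shows that its norm is zero. -/
theorem existsUnique_isForwardSolution {f : Space d × ℝ → ℝ}
    (hf : MemLp f 2 (volume.restrict P.Q)) (y₀ : L2 P.Ω) : ∃! y, P.IsForwardSolution f y₀ y := by
  obtain ⟨y, hy⟩ := P.exists_isForwardSolution hf y₀
  refine ⟨y, hy, fun y' hy' => ?_⟩
  obtain ⟨g, hyg, hy⟩ := P.isForwardSolution_iff.1 hy
  obtain ⟨g', hyg', hy'⟩ := P.isForwardSolution_iff.1 hy'
  obtain ⟨z, hz⟩ := P.exists_isBackwardSolution (y' - y)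
  obtain ⟨k, hzk, hz⟩ := P.isBackwardSolution_iff.1 hz
  have h := P.inner_eq_inner_of_satisfiesWeakForm (f := 0) (hyg'.sub hyg) (fun φ hφ => by
    rw [SatisfiesWeakForm.sub P hy' hy φ hφ]
    beta_reduce
    rw [sub_self, eq_comm]
    rw [← hφ.inner_val P.Q, inner_zero_left]) hzk hz
  rw [inner_zero_left, inner_self_eq_zero] at h
  exact sub_eq_zero.1 h

theorem existsUnique_isBackwardSolution (q : L2 P.Q) : ∃! z, P.IsBackwardSolution q z := by
  obtain ⟨z, hz⟩ := P.exists_isBackwardSolution q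
  refine ⟨z, hz, fun z' hz' => ?_⟩
  obtain ⟨k, hzk, hz⟩ := P.isBackwardSolution_iff.1 hz
  obtain ⟨k', hzk', hz'⟩ := P.isBackwardSolution_iff.1 hz'
  obtain ⟨y, hy⟩ := P.exists_isForwardSolution (Lp.memLp (z' - z)) 0
  have h := P.inner_eq_inner_of_solutions (q := 0) (Lp.memLp (z' - z)) hy
    (P.isBackwardSolution_iff.2 ⟨k' - k, hzk'.sub hzk, fun φ hφ => by
      rw [SatisfiesWeakForm.sub P hz' hz φ hφ]
      beta_reduce
      rw [sub_self, eq_comm]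
      rw [← hφ.inner_val P.Q, inner_zero_left]⟩)
  rw [inner_zero_right, Lp.toLp_coeFn, eq_comm, inner_self_eq_zero] at h
  exact sub_eq_zero.1 h

lemma memLp_extend (v : L2 P.Qω) : MemLp (P.extend v) 2 (volume.restrict P.Q) :=
  (memLp_indicator P.measurableSet_Qω v).restrict P.Q

lemma memLp_restrict_Qω (z : L2 P.Q) : MemLp z 2 (volume.restrict P.Qω) :=
  (Lp.memLp z).mono_measure (Measure.restrict_mono P.Qω_subset_Q le_rfl)

lemma Mstar_coeFn (q : L2 P.Q) :
    P.Mstar q =ᵐ[volume.restrict P.Qω] P.backwardState q := by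
  rw [Mstar, toL2, dif_pos (P.memLp_restrict_Qω _)]
  exact MemLp.coeFn_toLp _

/-- Green's formula with source `v 𝟙_ω`: the indicator restricts the pairing with the backward state
to `Q_ω`. -/
theorem inner_M (v : L2 P.Qω) (q : L2 P.Q) : inner ℝ (P.M v) q = inner ℝ v (P.Mstar q) := by
  have hy : P.IsForwardSolution (P.extend v) 0 (P.M v) :=
    Classical.epsilon_spec (P.exists_isForwardSolution (P.memLp_extend v) 0)
  have hz : P.IsBackwardSolution q (P.backwardState q) :=
    Classical.epsilon_spec (P.exists_isBackwardSolution q)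
  rw [P.inner_eq_inner_of_solutions (P.memLp_extend v) hy hz, L2.inner_def, L2.inner_def]
  have h1 : ∀ᵐ z ∂volume.restrict P.Q, inner ℝ ((P.memLp_extend v).toLp _ z)
      (P.backwardState q z) = P.Qω.indicator (fun z => inner ℝ (v z) (P.backwardState q z)) z := by
    filter_upwards [(P.memLp_extend v).coeFn_toLp] with z hz
    rw [hz]
    by_cases h : z ∈ P.Qω <;> simp [extend, h]
  rw [integral_congr_ae h1, setIntegral_indicator P.measurableSet_Qω,
    inter_eq_right.2 P.Qω_subset_Q]
  exact integral_congr_ae ((P.Mstar_coeFn q).mono fun z hz => by simp only [hz])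

end ControlProblem

end NullControl

namespace NullControl

variable {d : ℕ}

lemma fenchelConj_eq_coe {V W : Type*} {pairing : W → V → ℝ} {S : Set V} {f : V → ℝ} {w : W}
    {c : ℝ} (h : ∀ v ∈ S, pairing w v - f v ≤ c) {v₀ : V} (hv₀ : v₀ ∈ S)
    (h₀ : pairing w v₀ - f v₀ = c) : fenchelConj pairing S f w = c := by
  refine le_antisymm (iSup₂_le fun v hv => EReal.coe_le_coe_iff.2 (h v hv)) ?_
  exact le_iSup₂_of_le v₀ hv₀ (EReal.coe_le_coe_iff.2 h₀.ge)

namespace ControlProblem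

variable (P : ControlProblem d)

/-! ### The weights -/

lemma exists_pos_le_weight : ∃ k : ℝ, 0 < k ∧
    ∀ x ∈ closure P.Ω, k ≤ P.K₁ * (Real.exp P.K₂ - Real.exp (P.η x)) := by
  have hc : ContinuousOn (fun x => P.K₁ * (Real.exp P.K₂ - Real.exp (P.η x))) (closure P.Ω) :=
    continuousOn_const.mul (continuousOn_const.sub
      (Real.continuous_exp.comp_continuousOn P.η_C2.continuousOn))
  obtain ⟨x₀, hx₀, hmin⟩ := P.Ω_bounded.isCompact_closure.exists_isMinOn
    P.Ω_connected.nonempty.closure hc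
  refine ⟨_, ?_, hmin⟩
  exact mul_pos P.K₁_pos (sub_pos.2 (Real.exp_lt_exp.2 (P.K₂_large x₀ hx₀)))

lemma exists_pos_div_le_α : ∃ k : ℝ, 0 < k ∧ ∀ z ∈ P.Q, k / (P.T - z.2) ≤ P.α z := by
  obtain ⟨k, hk, h⟩ := P.exists_pos_le_weight
  refine ⟨k, hk, fun z hz => ?_⟩
  have : 0 < P.T - z.2 := sub_pos.2 hz.2.2
  rw [α, ← mul_div_assoc]
  exact div_le_div_of_nonneg_right (h z.1 (subset_closure hz.1)) this.le

lemma one_le_ρ {z : Space d × ℝ} (hz : z ∈ P.Q) : 1 ≤ P.ρ z := by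
  obtain ⟨k, hk, h⟩ := P.exists_pos_div_le_α
  have : 0 < P.T - z.2 := sub_pos.2 hz.2.2
  exact Real.one_le_exp ((div_pos hk this).le.trans (h z hz))

/-- The exponential blow-up of `ρ` beats the factor `s^{3/2}`, where `s = T - t`: from `e^x ≥ x` at
`x = 2k/(3s)` one gets `e^{k/s} ≥ (2k/(3s))^{3/2}`, and the powers of `s` cancel. -/
lemma exists_pos_le_ρ₀ : ∃ c : ℝ, 0 < c ∧ ∀ z ∈ P.Q, c ≤ P.ρ₀ z := by
  obtain ⟨k, hk, h⟩ := P.exists_pos_div_le_α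
  refine ⟨(2 / 3 * k) ^ (3 / 2 : ℝ), by positivity, fun z hz => ?_⟩
  have hs : 0 < P.T - z.2 := sub_pos.2 hz.2.2
  set s := P.T - z.2
  have h1 : (2 / 3 * (k / s)) ^ (3 / 2 : ℝ) ≤ Real.exp (k / s) := by
    have : Real.exp (k / s) = Real.exp (2 / 3 * (k / s)) ^ (3 / 2 : ℝ) := by
      rw [← Real.exp_mul]
      congr 1
      ring
    rw [this]
    refine Real.rpow_le_rpow (by positivity) ?_ (by norm_num)
    linarith [Real.add_one_le_exp (2 / 3 * (k / s))]
  calc (2 / 3 * k) ^ (3 / 2 : ℝ) = s ^ (3 / 2 : ℝ) * (2 / 3 * (k / s)) ^ (3 / 2 : ℝ) := by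
        rw [← Real.mul_rpow hs.le (by positivity)]
        congr 1
        field_simp
    _ ≤ s ^ (3 / 2 : ℝ) * P.ρ z :=
        mul_le_mul_of_nonneg_left (h1.trans (Real.exp_le_exp.2 (h z hz))) (by positivity)

lemma continuousOn_ρ : ContinuousOn P.ρ P.Q := by
  refine Real.continuous_exp.comp_continuousOn (continuousOn_const.mul (ContinuousOn.div
    (continuousOn_const.sub (Real.continuous_exp.comp_continuousOn ?_)) (by fun_prop) ?_))
  · exact P.η_C2.continuousOn.comp continuousOn_fst fun z hz => subset_closure hz.1
  · exact fun z hz => (sub_pos.2 hz.2.2).ne'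

lemma continuousOn_ρ₀ : ContinuousOn P.ρ₀ P.Q :=
  ContinuousOn.mul (ContinuousOn.rpow_const (by fun_prop) fun _ _ => Or.inr (by norm_num))
    P.continuousOn_ρ

lemma ρ₀_pos {z : Space d × ℝ} (hz : z ∈ P.Q) : 0 < P.ρ₀ z := by
  obtain ⟨c, hc, h⟩ := P.exists_pos_le_ρ₀
  exact hc.trans_le (h z hz)

lemma ae_ρ₀_pos : ∀ᵐ z ∂volume.restrict P.Qω, 0 < P.ρ₀ z := by
  filter_upwards [ae_restrict_mem P.measurableSet_Qω] with z hz
  exact P.ρ₀_pos (P.Qω_subset_Q hz)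

lemma memLp_inv_ρ₀ : MemLp (fun z => (P.ρ₀ z)⁻¹) ⊤ (volume.restrict P.Qω) := by
  obtain ⟨c, hc, h⟩ := P.exists_pos_le_ρ₀
  have hm : ContinuousOn (fun z => (P.ρ₀ z)⁻¹) P.Qω :=
    (P.continuousOn_ρ₀.mono P.Qω_subset_Q).inv₀ fun z hz => (P.ρ₀_pos (P.Qω_subset_Q hz)).ne'
  refine memLp_top_of_bound (hm.aestronglyMeasurable P.measurableSet_Qω) c⁻¹ ?_
  filter_upwards [ae_restrict_mem P.measurableSet_Qω] with z hz
  have hzQ := P.Qω_subset_Q hz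
  rw [Real.norm_of_nonneg (inv_nonneg.2 (P.ρ₀_pos hzQ).le)]
  exact inv_anti₀ hc (h z hzQ)

variable {R : ℝ}

lemma min_le_ρR {z : Space d × ℝ} (hz : z ∈ P.Q) : min R 1 ≤ P.ρR R z :=
  min_le_min le_rfl (P.one_le_ρ hz)

lemma ρR_pos (hR : 0 < R) {z : Space d × ℝ} (hz : z ∈ P.Q) : 0 < P.ρR R z :=
  (lt_min hR one_pos).trans_le (P.min_le_ρR hz)

lemma continuousOn_ρR : ContinuousOn (P.ρR R) P.Q := continuousOn_const.inf P.continuousOn_ρ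

lemma memLp_ρR (hR : 0 < R) : MemLp (P.ρR R) ⊤ (volume.restrict P.Q) := by
  refine memLp_top_of_bound (P.continuousOn_ρR.aestronglyMeasurable P.measurableSet_Q) R ?_
  filter_upwards [ae_restrict_mem P.measurableSet_Q] with z hz
  rw [Real.norm_of_nonneg (P.ρR_pos hR hz).le]
  exact min_le_left _ _

lemma memLp_inv_ρR (hR : 0 < R) : MemLp (fun z => (P.ρR R z)⁻¹) ⊤ (volume.restrict P.Q) := by
  have hm : ContinuousOn (fun z => (P.ρR R z)⁻¹) P.Q :=
    P.continuousOn_ρR.inv₀ fun z hz => (P.ρR_pos hR hz).ne'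
  refine memLp_top_of_bound (hm.aestronglyMeasurable P.measurableSet_Q) (min R 1)⁻¹ ?_
  filter_upwards [ae_restrict_mem P.measurableSet_Q] with z hz
  rw [Real.norm_of_nonneg (inv_nonneg.2 (P.ρR_pos hR hz).le)]
  exact inv_anti₀ (lt_min hR one_pos) (P.min_le_ρR hz)

/-- Division by `ρ₀`, an isomorphism of `L²(Q_ω)` onto the space of controls. -/
def divρ₀ : L2 P.Qω →L[ℝ] L2 P.Qω := mulL P.memLp_inv_ρ₀

/-- Multiplication by `ρ_R`. -/
def mulρR (hR : 0 < R) : L2 P.Q →L[ℝ] L2 P.Q := mulL (P.memLp_ρR hR)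

/-- Division by `ρ_R`. -/
def divρR (hR : 0 < R) : L2 P.Q →L[ℝ] L2 P.Q := mulL (P.memLp_inv_ρR hR)

lemma mulρR_divρR (hR : 0 < R) (q : L2 P.Q) : P.mulρR hR (P.divρR hR q) = q := by
  refine mulL_mulL_cancel _ _ ?_ q
  filter_upwards [ae_restrict_mem P.measurableSet_Q] with z hz
  exact mul_inv_cancel₀ (P.ρR_pos hR hz).ne'

lemma divρR_mulρR (hR : 0 < R) (q : L2 P.Q) : P.divρR hR (P.mulρR hR q) = q := by
  refine mulL_mulL_cancel _ _ ?_ q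
  filter_upwards [ae_restrict_mem P.measurableSet_Q] with z hz
  exact inv_mul_cancel₀ (P.ρR_pos hR hz).ne'

lemma inner_divρR_mulρR (hR : 0 < R) (q y : L2 P.Q) :
    inner ℝ (P.divρR hR q) (P.mulρR hR y) = inner ℝ q y := by
  rw [divρR, inner_mulL]
  exact congrArg _ (P.divρR_mulρR hR y)

lemma divρ₀_mem_U (u : L2 P.Qω) : P.divρ₀ u ∈ P.U := by
  refine (memLp_congr_ae ?_).2 (Lp.memLp u)
  filter_upwards [mulL_coeFn P.memLp_inv_ρ₀ u, P.ae_ρ₀_pos] with z h1 h2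
  rw [divρ₀, h1, smul_eq_mul, mul_inv_cancel_left₀ h2.ne']

/-- The weight `ρ₀` need not be bounded, so multiplication by it is not available on `L²(Q_ω)`.
Writing `v = ρ₀⁻¹ u` instead turns the constrained variable `v ∈ 𝒰` into a free one with `G(v) =
½‖u‖²`. -/
lemma exists_eq_divρ₀ {v : L2 P.Qω} (hv : v ∈ P.U) : ∃ u, P.divρ₀ u = v := by
  have hv' : MemLp (fun z => P.ρ₀ z * v z) 2 (volume.restrict P.Qω) := hv
  refine ⟨hv'.toLp _, Lp.ext ?_⟩
  filter_upwards [mulL_coeFn P.memLp_inv_ρ₀ (hv'.toLp _), hv'.coeFn_toLp, P.ae_ρ₀_pos]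
    with z h1 h2 h3
  rw [divρ₀, h1, h2, smul_eq_mul, inv_mul_cancel_left₀ h3.ne']

lemma G_divρ₀ (u : L2 P.Qω) : P.G (P.divρ₀ u) = 1 / 2 * ‖u‖ ^ 2 := by
  rw [G, norm_sq_eq_integral]
  congr 1
  refine integral_congr_ae ?_
  filter_upwards [mulL_coeFn P.memLp_inv_ρ₀ u, P.ae_ρ₀_pos] with z h1 h2
  rw [divρ₀, h1, smul_eq_mul, ← mul_pow, mul_inv_cancel_left₀ h2.ne']

lemma Fbar_eq (hR : 0 < R) (y : L2 P.Q) :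
    P.Fbar R y = 1 / 2 * ‖P.mulρR hR (y + P.ybar)‖ ^ 2 := by
  rw [Fbar, F, mulρR, norm_mulL_sq]

lemma norm_divρR_sq (hR : 0 < R) (q : L2 P.Q) :
    ‖P.divρR hR q‖ ^ 2 = ∫ z in P.Q, (P.ρR R z ^ 2)⁻¹ * q z ^ 2 := by
  rw [divρR, norm_mulL_sq]
  simp_rw [inv_pow]

/-! ### Duality -/

/-- The value of the dual functional `Φ_R*(0, q)`. -/
def dualValue (hR : 0 < R) (q : L2 P.Q) : ℝ :=
  1 / 2 * ‖P.divρ₀ (P.Mstar q)‖ ^ 2 + 1 / 2 * ‖P.divρR hR q‖ ^ 2 + inner ℝ q P.ybar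

lemma norm_divρR_add_mulρR_sq (hR : 0 < R) (q y : L2 P.Q) :
    ‖P.divρR hR q + P.mulρR hR y‖ ^ 2 =
      ‖P.divρR hR q‖ ^ 2 + 2 * inner ℝ q y + ‖P.mulρR hR y‖ ^ 2 := by
  rw [norm_add_sq_real, inner_divρR_mulρR]

lemma inner_divρ₀_Mstar (u : L2 P.Qω) (q : L2 P.Q) :
    inner ℝ u (P.divρ₀ (P.Mstar q)) = inner ℝ q (P.M (P.divρ₀ u)) := by
  rw [divρ₀, ← inner_mulL, ← inner_M, real_inner_comm]

/-- Completion of the square in `q`; the cross term loses its weights because `ρ_R⁻¹ ρ_R = 1`. -/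
lemma Lag_eq_I_sub (hR : 0 < R) (v : L2 P.Qω) (q : L2 P.Q) :
    P.Lag R v q = P.I R v - 1 / 2 * ‖P.divρR hR q + P.mulρR hR (P.M v + P.ybar)‖ ^ 2 := by
  rw [Lag, I, P.Fbar_eq hR, norm_divρR_add_mulρR_sq, norm_divρR_sq]
  ring

/-- Completion of the square in `u = ρ₀ v`, after `M` has been moved to the other side as `M*`. -/
lemma Lag_divρ₀ (hR : 0 < R) (u : L2 P.Qω) (q : L2 P.Q) :
    P.Lag R (P.divρ₀ u) q =
      1 / 2 * ‖u - P.divρ₀ (P.Mstar q)‖ ^ 2 - P.dualValue hR q := by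
  rw [Lag, G_divρ₀, dualValue, norm_sub_sq_real, inner_divρ₀_Mstar, norm_divρR_sq, inner_add_right]
  ring

lemma Lag_le_I (hR : 0 < R) (v : L2 P.Qω) (q : L2 P.Q) : P.Lag R v q ≤ P.I R v := by
  rw [P.Lag_eq_I_sub hR]
  exact sub_le_self _ (by positivity)

lemma neg_dualValue_le_Lag (hR : 0 < R) {v : L2 P.Qω} (hv : v ∈ P.U) (q : L2 P.Q) :
    -P.dualValue hR q ≤ P.Lag R v q := by
  obtain ⟨u, rfl⟩ := P.exists_eq_divρ₀ hv
  rw [P.Lag_divρ₀ hR]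
  have : 0 ≤ 1 / 2 * ‖u - P.divρ₀ (P.Mstar q)‖ ^ 2 := by positivity
  linarith

lemma iSup_Lag (hR : 0 < R) (v : L2 P.Qω) : (⨆ q, (P.Lag R v q : EReal)) = P.I R v := by
  refine le_antisymm (iSup_le fun q => EReal.coe_le_coe_iff.2 (P.Lag_le_I hR v q)) ?_
  -- The maximizer `q = -ρ_R² (M v + ȳ)` is the zero of the square in `Lag_eq_I_sub`.
  refine le_iSup_of_le (-P.mulρR hR (P.mulρR hR (P.M v + P.ybar))) (EReal.coe_le_coe_iff.2 ?_)
  rw [P.Lag_eq_I_sub hR, map_neg, divρR_mulρR, neg_add_cancel, norm_zero]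
  simp

lemma iInf_Lag (hR : 0 < R) (q : L2 P.Q) :
    (⨅ v ∈ P.U, (P.Lag R v q : EReal)) = ((-P.dualValue hR q : ℝ) : EReal) := by
  refine le_antisymm ?_
    (le_iInf₂ fun v hv => EReal.coe_le_coe_iff.2 (P.neg_dualValue_le_Lag hR hv q))
  refine iInf₂_le_of_le _ (P.divρ₀_mem_U (P.divρ₀ (P.Mstar q))) (EReal.coe_le_coe_iff.2 ?_)
  rw [P.Lag_divρ₀ hR, sub_self, norm_zero]
  simp

lemma FbarStar_neg (hR : 0 < R) (q : L2 P.Q) : P.FbarStar R (-q) =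
    ((1 / 2 * ‖P.divρR hR q‖ ^ 2 + inner ℝ q P.ybar : ℝ) : EReal) := by
  have key : ∀ y : L2 P.Q, inner ℝ (-q) y - P.Fbar R y =
      (1 / 2 * ‖P.divρR hR q‖ ^ 2 + inner ℝ q P.ybar) -
        1 / 2 * ‖P.divρR hR q + P.mulρR hR (y + P.ybar)‖ ^ 2 := by
    intro y
    rw [P.Fbar_eq hR, norm_divρR_add_mulρR_sq, inner_neg_left, inner_add_right]
    ring
  -- The supremum is attained at `y = -ρ_R⁻² q - ȳ`, where the square vanishes.
  refine fenchelConj_eq_coe (fun y _ => ?_)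
    (mem_univ (-P.divρR hR (P.divρR hR q) - P.ybar)) ?_
  · rw [key]
    exact sub_le_self _ (by positivity)
  · rw [key, sub_add_cancel, map_neg, mulρR_divρR, add_neg_cancel, norm_zero]
    simp

lemma GStar_eq (w : L2 P.Qω) : P.GStar w = ((1 / 2 * ‖P.divρ₀ w‖ ^ 2 : ℝ) : EReal) := by
  have key : ∀ u : L2 P.Qω, inner ℝ w (P.divρ₀ u) - P.G (P.divρ₀ u) =
      1 / 2 * ‖P.divρ₀ w‖ ^ 2 - 1 / 2 * ‖u - P.divρ₀ w‖ ^ 2 := by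
    intro u
    rw [G_divρ₀, norm_sub_sq_real, divρ₀, ← inner_mulL, real_inner_comm]
    ring
  refine fenchelConj_eq_coe (fun v hv => ?_) (P.divρ₀_mem_U (P.divρ₀ w)) ?_
  · obtain ⟨u, rfl⟩ := P.exists_eq_divρ₀ hv
    rw [key]
    exact sub_le_self _ (by positivity)
  · rw [key, sub_self, norm_zero]
    simp

lemma ΦStar_zero (hR : 0 < R) (q : L2 P.Q) : P.ΦStar R 0 q = (P.dualValue hR q : EReal) := by
  have key : ∀ (u : L2 P.Qω) (p : L2 P.Q),
      inner ℝ (0 : L2 P.Qω) (P.divρ₀ u) + inner ℝ q p - P.Φ R (P.divρ₀ u, p) =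
        P.dualValue hR q - 1 / 2 * ‖u - P.divρ₀ (P.Mstar q)‖ ^ 2 -
          1 / 2 * ‖P.divρR hR q + P.mulρR hR (P.M (P.divρ₀ u) - p + P.ybar)‖ ^ 2 := by
    intro u p
    rw [Φ, P.Fbar_eq hR, G_divρ₀, norm_divρR_add_mulρR_sq, norm_sub_sq_real, inner_divρ₀_Mstar,
      dualValue, inner_add_right, inner_sub_right, inner_zero_left]
    ring
  -- The choice `v = ρ₀⁻² M* q` kills the first square, and then `p = M v + ȳ + ρ_R⁻² q` kills the
  -- second.
  refine fenchelConj_eq_coe (fun vp hvp => ?_)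
    (v₀ := (P.divρ₀ (P.divρ₀ (P.Mstar q)), P.M (P.divρ₀ (P.divρ₀ (P.Mstar q))) + P.ybar +
      P.divρR hR (P.divρR hR q))) ⟨P.divρ₀_mem_U _, mem_univ _⟩ ?_
  · obtain ⟨v, p⟩ := vp
    obtain ⟨u, rfl⟩ := P.exists_eq_divρ₀ hvp.1
    refine (key u p).trans_le ?_
    have h1 : 0 ≤ 1 / 2 * ‖u - P.divρ₀ (P.Mstar q)‖ ^ 2 := by positivity
    have h2 : 0 ≤ 1 / 2 * ‖P.divρR hR q + P.mulρR hR (P.M (P.divρ₀ u) - p + P.ybar)‖ ^ 2 := by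
      positivity
    linarith
  · refine (key _ _).trans ?_
    have : ∀ a b c : L2 P.Q, a - (a + b + c) + b = -c := fun a b c => by abel
    rw [this, map_neg, mulρR_divρR, sub_self, add_neg_cancel, norm_zero, norm_zero]
    simp

/-- The optimality system, reduced to the dual variable: `ρ_R⁻¹ q + ρ_R (M v + ȳ) = 0`, where
`v = ρ₀⁻² M* q`. -/
abbrev OptimalitySystem (hR : 0 < R) (q : L2 P.Q) : Prop :=
  P.divρR hR q + P.mulρR hR (P.M (P.divρ₀ (P.divρ₀ (P.Mstar q))) + P.ybar) = 0

theorem exists_optimalitySystem (hR : 0 < R) : ∃ q, P.OptimalitySystem hR q := by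
  -- `M` and `M*` are defined by choice, as bare functions; the adjoint identity alone supplies
  -- their linearity and continuity.
  obtain ⟨A, hA⟩ := exists_clm_of_adjoint P.M P.Mstar P.inner_M
  obtain ⟨B, hB⟩ := exists_clm_of_adjoint P.Mstar P.M fun q v => by
    rw [real_inner_comm, ← inner_M, real_inner_comm]
  obtain ⟨q, hq⟩ := exists_optimality_system (A ∘L P.divρ₀) (P.divρ₀ ∘L B) (P.divρR hR)
    (P.mulρR hR) (fun u q => by
      simp only [ContinuousLinearMap.comp_apply, hA, hB]
      rw [inner_divρ₀_Mstar, real_inner_comm]) (inner_mulL _) (P.mulρR_divρR hR) P.ybar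
  refine ⟨q, ?_⟩
  -- Lax–Milgram gives `ρ_R⁻² q + M ρ₀⁻² M* q + ȳ = 0`; multiplication by `ρ_R` puts it in the form
  -- of the square in the duality gap.
  have h := congrArg (P.mulρR hR) hq
  simp only [ContinuousLinearMap.comp_apply, hA, hB] at h
  rwa [add_assoc, map_add, mulρR_divρR, map_zero] at h

/-! ### Consequences of the duality gap and of the optimality system -/

section Optimal

variable {P} {q : L2 P.Q} (hR : 0 < R)

/-- The duality gap. -/
lemma I_add_dualValue (u : L2 P.Qω) (q : L2 P.Q) :
    P.I R (P.divρ₀ u) + P.dualValue hR q =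
      1 / 2 * ‖P.divρR hR q + P.mulρR hR (P.M (P.divρ₀ u) + P.ybar)‖ ^ 2 +
        1 / 2 * ‖u - P.divρ₀ (P.Mstar q)‖ ^ 2 := by
  linarith [P.Lag_eq_I_sub hR (P.divρ₀ u) q, P.Lag_divρ₀ hR u q]

lemma I_optimal (hq : P.OptimalitySystem hR q) :
    P.I R (P.divρ₀ (P.divρ₀ (P.Mstar q))) = -P.dualValue hR q := by
  have h := I_add_dualValue hR (P.divρ₀ (P.Mstar q)) q
  rw [hq, sub_self, norm_zero, norm_zero] at h
  linarith

lemma Lag_optimal : P.Lag R (P.divρ₀ (P.divρ₀ (P.Mstar q))) q = -P.dualValue hR q := by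
  rw [P.Lag_divρ₀ hR, sub_self, norm_zero]
  ring

/-- A nonpositive gap forces both squares to vanish; the one in `u` determines the control. -/
lemma eq_of_I_le {v : L2 P.Qω} (hv : v ∈ P.U) (h : P.I R v ≤ -P.dualValue hR q) :
    v = P.divρ₀ (P.divρ₀ (P.Mstar q)) := by
  obtain ⟨u, rfl⟩ := P.exists_eq_divρ₀ hv
  have h1 := I_add_dualValue hR u q
  have h2 : ‖u - P.divρ₀ (P.Mstar q)‖ ^ 2 ≤ 0 := by
    linarith [sq_nonneg ‖P.divρR hR q + P.mulρR hR (P.M (P.divρ₀ u) + P.ybar)‖]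
  have h3 := pow_eq_zero_iff two_ne_zero |>.1 (le_antisymm h2 (sq_nonneg _))
  rw [sub_eq_zero.1 (norm_eq_zero.1 h3)]

/-- The gap between the optimal control and `p` is nonpositive, so `p` satisfies the same equation
`ρ_R⁻¹ p = -ρ_R (M v + ȳ)` as `q`, with the same `v`. -/
lemma eq_of_dualValue_le (hq : P.OptimalitySystem hR q) {p : L2 P.Q}
    (h : P.dualValue hR p ≤ P.dualValue hR q) : p = q := by
  have h1 := I_add_dualValue hR (P.divρ₀ (P.Mstar q)) p
  have h2 := I_optimal hR hq
  have h3 : ‖P.divρR hR p + P.mulρR hR (P.M (P.divρ₀ (P.divρ₀ (P.Mstar q))) + P.ybar)‖ ^ 2 ≤ 0 := by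
    linarith [sq_nonneg ‖P.divρ₀ (P.Mstar q) - P.divρ₀ (P.Mstar p)‖]
  have h4 := norm_eq_zero.1 (pow_eq_zero_iff two_ne_zero |>.1 (le_antisymm h3 (sq_nonneg _)))
  have h5 := congrArg (P.mulρR hR) (add_right_cancel (h4.trans hq.symm))
  rwa [mulρR_divρR, mulρR_divρR] at h5

lemma isPrimalSolution_iff (hq : P.OptimalitySystem hR q) (v : L2 P.Qω) :
    P.IsPrimalSolution R v ↔ v = P.divρ₀ (P.divρ₀ (P.Mstar q)) := by
  constructor
  · rintro ⟨hv, h⟩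
    exact eq_of_I_le hR hv ((h _ (P.divρ₀_mem_U _)).trans_eq (I_optimal hR hq))
  · rintro rfl
    refine ⟨P.divρ₀_mem_U _, fun w hw => ?_⟩
    rw [I_optimal hR hq]
    exact (P.neg_dualValue_le_Lag hR hw q).trans (P.Lag_le_I hR w q)

lemma isDualSolution_iff (hq : P.OptimalitySystem hR q) (p : L2 P.Q) :
    P.IsDualSolution R p ↔ p = q := by
  have h0 : P.IsDualSolution R p ↔ ∀ p', P.dualValue hR p ≤ P.dualValue hR p' := by
    refine forall_congr' fun p' => ?_
    rw [P.ΦStar_zero hR, P.ΦStar_zero hR, EReal.neg_le_neg_iff, EReal.coe_le_coe_iff]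
  rw [h0]
  constructor
  · exact fun h => eq_of_dualValue_le hR hq (h q)
  · rintro rfl p'
    have := (P.neg_dualValue_le_Lag hR (P.divρ₀_mem_U (P.divρ₀ (P.Mstar p))) p').trans
      (P.Lag_le_I hR _ p')
    linarith [I_optimal hR hq]

lemma isSaddlePoint_optimal (hq : P.OptimalitySystem hR q) :
    P.IsSaddlePoint R (P.divρ₀ (P.divρ₀ (P.Mstar q))) q := by
  refine ⟨P.divρ₀_mem_U _, fun p => ?_, fun w hw => ?_⟩
  · rw [Lag_optimal hR, ← I_optimal hR hq]
    exact P.Lag_le_I hR _ p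
  · rw [Lag_optimal hR]
    exact P.neg_dualValue_le_Lag hR hw q

/-- The saddle inequalities give `I_R(v) ≤ L_R(v,p) ≤ -D(p)`, while weak duality gives `-D(p) ≤
-D(q) ≤ I_R(v)`. All four values coincide, so `v` and `p` are both optimal. -/
lemma eq_of_isSaddlePoint (hq : P.OptimalitySystem hR q)
    {v : L2 P.Qω} {p : L2 P.Q} (h : P.IsSaddlePoint R v p) :
    v = P.divρ₀ (P.divρ₀ (P.Mstar q)) ∧ p = q := by
  obtain ⟨hv, h1, h2⟩ := h
  have h3 : P.I R v ≤ P.Lag R v p := by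
    have := iSup_le fun r => EReal.coe_le_coe_iff.2 (h1 r)
    rw [P.iSup_Lag hR] at this
    exact EReal.coe_le_coe_iff.1 this
  have h4 : P.Lag R v p ≤ -P.dualValue hR p := by
    have := le_iInf₂ fun w hw => EReal.coe_le_coe_iff.2 (h2 w hw)
    rw [P.iInf_Lag hR] at this
    exact EReal.coe_le_coe_iff.1 this
  have h5 := (P.neg_dualValue_le_Lag hR (P.divρ₀_mem_U (P.divρ₀ (P.Mstar q))) p).trans
    (P.Lag_le_I hR _ p)
  have h6 := (P.neg_dualValue_le_Lag hR hv q).trans (P.Lag_le_I hR v q)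
  have h7 := I_optimal hR hq
  exact ⟨eq_of_I_le hR hv (by linarith), eq_of_dualValue_le hR hq (by linarith)⟩

lemma iInf_iSup_Lag (hq : P.OptimalitySystem hR q) : (⨅ v ∈ P.U, ⨆ p, (P.Lag R v p : EReal)) =
    P.Lag R (P.divρ₀ (P.divρ₀ (P.Mstar q))) q := by
  simp_rw [P.iSup_Lag hR]
  rw [Lag_optimal hR]
  refine le_antisymm ?_ (le_iInf₂ fun v hv => EReal.coe_le_coe_iff.2
    ((P.neg_dualValue_le_Lag hR hv q).trans (P.Lag_le_I hR v q)))
  refine iInf₂_le_of_le _ (P.divρ₀_mem_U (P.divρ₀ (P.Mstar q))) (EReal.coe_le_coe_iff.2 ?_)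
  exact (I_optimal hR hq).le

lemma iSup_iInf_Lag (hq : P.OptimalitySystem hR q) : (⨆ p, ⨅ v ∈ P.U, (P.Lag R v p : EReal)) =
    P.Lag R (P.divρ₀ (P.divρ₀ (P.Mstar q))) q := by
  simp_rw [P.iInf_Lag hR]
  rw [Lag_optimal hR]
  refine le_antisymm (iSup_le fun p => EReal.coe_le_coe_iff.2 ?_) (le_iSup_of_le q le_rfl)
  rw [← I_optimal hR hq]
  exact (P.neg_dualValue_le_Lag hR (P.divρ₀_mem_U _) p).trans (P.Lag_le_I hR _ p)

/-- Equality in the Fenchel–Young inequality: the defect is half the square that the optimality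
system annihilates. -/
lemma Fbar_add_FbarStar_optimal (hq : P.OptimalitySystem hR q) :
    (P.Fbar R (P.M (P.divρ₀ (P.divρ₀ (P.Mstar q)))) : EReal) + P.FbarStar R (-q) =
      ((-inner ℝ (P.M (P.divρ₀ (P.divρ₀ (P.Mstar q)))) q : ℝ) : EReal) := by
  rw [P.FbarStar_neg hR, ← EReal.coe_add, EReal.coe_eq_coe_iff, P.Fbar_eq hR]
  have h := P.norm_divρR_add_mulρR_sq hR q (P.M (P.divρ₀ (P.divρ₀ (P.Mstar q))) + P.ybar)
  rw [hq, norm_zero, inner_add_right] at h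
  rw [real_inner_comm q]
  linarith

lemma state_optimal (hq : P.OptimalitySystem hR q) : ∀ᵐ z ∂(volume.restrict P.Q),
    (P.M (P.divρ₀ (P.divρ₀ (P.Mstar q))) + P.ybar) z = -((P.ρR R z ^ 2)⁻¹ * q z) := by
  have h := congrArg (P.divρR hR) hq
  rw [map_add, divρR_mulρR, map_zero, add_comm] at h
  rw [eq_neg_of_add_eq_zero_left h]
  filter_upwards [Lp.coeFn_neg (P.divρR hR (P.divρR hR q)),
    mulL_coeFn (P.memLp_inv_ρR hR) (P.divρR hR q), mulL_coeFn (P.memLp_inv_ρR hR) q]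
    with z h1 h2 h3
  rw [h1, Pi.neg_apply]
  congr 1
  refine h2.trans ?_
  rw [divρR, h3, smul_eq_mul, smul_eq_mul, ← mul_assoc, ← mul_inv, pow_two]

end Optimal

/-- Fenchel–Young equality holds here for every `q`, because `ρ₀⁻² w` maximizes `⟨w, v⟩ - G(v)` for
any `w`; optimality of `q` plays no role. -/
lemma G_add_GStar (q : L2 P.Q) :
    (P.G (P.divρ₀ (P.divρ₀ (P.Mstar q))) : EReal) + P.GStar (P.Mstar q) =
      ((inner ℝ (P.Mstar q) (P.divρ₀ (P.divρ₀ (P.Mstar q))) : ℝ) : EReal) := by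
  rw [GStar_eq, ← EReal.coe_add, EReal.coe_eq_coe_iff, G_divρ₀]
  have : inner ℝ (P.Mstar q) (P.divρ₀ (P.divρ₀ (P.Mstar q))) = ‖P.divρ₀ (P.Mstar q)‖ ^ 2 := by
    rw [← real_inner_self_eq_norm_sq]
    exact (inner_mulL P.memLp_inv_ρ₀ _ _).symm
  rw [this]
  ring

lemma divρ₀_divρ₀_coeFn (w : L2 P.Qω) : ∀ᵐ z ∂(volume.restrict P.Qω),
    P.divρ₀ (P.divρ₀ w) z = (P.ρ₀ z ^ 2)⁻¹ * w z := by
  filter_upwards [mulL_coeFn P.memLp_inv_ρ₀ (P.divρ₀ w), mulL_coeFn P.memLp_inv_ρ₀ w]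
    with z h1 h2
  refine h1.trans ?_
  rw [divρ₀, h2, smul_eq_mul, smul_eq_mul, ← mul_assoc, ← mul_inv, pow_two]

end ControlProblem

end NullControl

end

theorem theorem3p1 {d : ℕ} (hd : 1 ≤ d) (P : NullControl.ControlProblem d) (R : ℝ) (hR : 0 < R) :
    -- the problems that define `M`, `ȳ` and `M*` are well posed, and `M*` is the adjoint of `M`
    ((∀ v, ∃! y, P.IsForwardSolution (P.extend v) 0 y) ∧
      (∃! y, P.IsForwardSolution 0 P.y₀ y) ∧
      (∀ q, ∃! z, P.IsBackwardSolution q z) ∧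
      (∀ v q, inner ℝ (P.M v) q = inner ℝ v (P.Mstar q))) ∧
    -- the primal and the dual problem are uniquely solvable
    ((∃! v, P.IsPrimalSolution R v) ∧ (∃! q, P.IsDualSolution R q)) ∧
    -- the optimal values are the inf-sup and the sup-inf of the Lagrangian
    ((⨅ v ∈ P.U, (P.I R v : EReal)) = (⨅ v ∈ P.U, ⨆ q, (P.Lag R v q : EReal)) ∧
      (⨆ q, -P.ΦStar R 0 q) = (⨆ q, ⨅ v ∈ P.U, (P.Lag R v q : EReal))) ∧
    -- properties of the solutions `v_R` and `q_R`
    (∀ vR qR, P.IsPrimalSolution R vR → P.IsDualSolution R qR →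
      -- they form the unique saddle point
      P.IsSaddlePoint R vR qR ∧
      (∀ v q, P.IsSaddlePoint R v q → v = vR ∧ q = qR) ∧
      (⨅ v ∈ P.U, ⨆ q, (P.Lag R v q : EReal)) = (P.Lag R vR qR : EReal) ∧
      (P.Lag R vR qR : EReal) = (⨆ q, ⨅ v ∈ P.U, (P.Lag R v q : EReal)) ∧
      -- extremality relations
      (P.Fbar R (P.M vR) : EReal) + P.FbarStar R (-qR) = ((-inner ℝ (P.M vR) qR : ℝ) : EReal) ∧
      (P.G vR : EReal) + P.GStar (P.Mstar qR) = ((inner ℝ (P.Mstar qR) vR : ℝ) : EReal) ∧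
      -- `y_R = -ρ_R⁻² q_R` and `v_R = ρ₀⁻² M* q_R`, where `y_R = M v_R + ȳ`
      (∀ᵐ z ∂(MeasureTheory.volume.restrict P.Q),
        (P.M vR + P.ybar) z = -((P.ρR R z ^ 2)⁻¹ * qR z)) ∧
      (∀ᵐ z ∂(MeasureTheory.volume.restrict P.Qω),
        vR z = (P.ρ₀ z ^ 2)⁻¹ * P.Mstar qR z)) := by
  obtain ⟨q, hq⟩ := P.exists_optimalitySystem hR
  have hprimal := NullControl.ControlProblem.isPrimalSolution_iff hR hq
  have hdual := NullControl.ControlProblem.isDualSolution_iff hR hq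
  refine ⟨⟨fun v => P.existsUnique_isForwardSolution (P.memLp_extend v) 0,
    P.existsUnique_isForwardSolution MeasureTheory.MemLp.zero P.y₀,
    P.existsUnique_isBackwardSolution, P.inner_M⟩, ⟨?_, ?_⟩, ⟨?_, ?_⟩, ?_⟩
  · simp_rw [hprimal]
    exact existsUnique_eq
  · simp_rw [hdual]
    exact existsUnique_eq
  · simp_rw [P.iSup_Lag hR]
  · simp_rw [P.iInf_Lag hR, P.ΦStar_zero hR]
    rfl
  · intro vR qR hv hqR
    obtain rfl := (hdual qR).1 hqR
    obtain rfl := (hprimal vR).1 hv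
    exact ⟨NullControl.ControlProblem.isSaddlePoint_optimal hR hq,
      fun v q h => NullControl.ControlProblem.eq_of_isSaddlePoint hR hq h,
      NullControl.ControlProblem.iInf_iSup_Lag hR hq,
      (NullControl.ControlProblem.iSup_iInf_Lag hR hq).symm,
      NullControl.ControlProblem.Fbar_add_FbarStar_optimal hR hq, P.G_add_GStar qR,
      NullControl.ControlProblem.state_optimal hR hq, P.divρ₀_divρ₀_coeFn (P.Mstar qR)⟩
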